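/- Let $C^*(\mathbb F_1)$ be the full group C$^*$-algebra of the free group on one generator, with canonical unitary generator $u$, and let $\mathcal S_1=\mathrm{span}\{1,u,u^*\}\subseteq C^*(\mathbb F_1)$, an operator system. For operator systems $\mathcal S\subseteq\mathcal B(\mathcal H)$ and $\mathcal T\subseteq\mathcal B(\mathcal K)$, consider three operator system structures on $\mathcal S\otimes\mathcal T$, given by the following cones for $n\in\mathbb N$. (min) $M_n(\mathcal S\otimes_{\min}\mathcal T)_+$ consists of the matrices over $\mathcal S\otimes\mathcal T\subseteq\mathcal B(\mathcal H\otimes\mathcal K)$ that are positive operators on $(\mathcal H\otimes\mathcal K)^n$. (c) $M_n(\mathcal S\otimes_{c}\mathcal T)_+$ consists of the $X$ such that $(\phi\cdot\psi)^{(n)}(X)\ge 0$ for every Hilbert space $\mathcal L$ and all completely positive maps $\phi:\mathcal S\to\mathcal B(\mathcal L)$, $\psi:\mathcal T\to\mathcal B(\mathcal L)$ with commuting ranges, where $\phi\cdot\psi(s\otimes t)=\phi(s)\psi(t)$. (max) $M_n(\mathcal S\otimes_{\max}\mathcal T)_+$ consists of the $X$ such that $\varepsilon 1_n+X\in D_n$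 for every $\varepsilon>0$, where $1_n$ is the diagonal matrix with diagonal entries $1\otimes 1$ and $$D_n=\{A^*(P\otimes Q)A:\ k,m\in\mathbb N,\ P\in M_k(\mathcal S)_+,\ Q\in M_m(\mathcal T)_+,\ A\in M_{km,n}(\mathbb C)\}.$$ Then the following hold. 1. The identity map $\iota=\mathrm{id}\otimes\mathrm{id}:\mathcal S_1\otimes_{\min}\mathcal S_1\to\mathcal S_1\otimes_{\max}\mathcal S_1$ is positive but not $2$-positive. 2. There is a $*$-isomorphism $C^*(\mathbb F_1)\cong C(\mathbb T)$ taking $u$ to the identity function of $\mathbb T$. Under it, with $z=u\otimes 1$ and $w=1\otimes u$ viewed as the coordinate functions on $\mathbb T^2$, the matrix $$h=\begin{bmatrix}3\,(1\otimes1)+u\otimes u+u^*\otimes u^* & 2\,u^*\otimes u\\ 2\,u\otimes u^* & 3\,(1\otimes 1)-u\otimes u-u^*\otimes u^*\end{bmatrix}\in M_2(\mathcal S_1\otimes\mathcal S_1)$$ is the function $$h(z,w)=\begin{bmatrix}3+2\,\mathrm{Re}(zw) & 2\bar z w\\ 2z\bar w & 3-2\,\mathrm{Re}(zw)\end{bmatrix},\qquad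 z,w\in\mathbb T.$$ There is $\delta>0$ such that $h(z,w)-\delta I$ is positive semidefinite for all $z,w\in\mathbb T$. The matrix $h$ is strictly positive in $M_2(\mathcal S_1\otimes_{\min}\mathcal S_1)$ (that is, $h-\delta 1_2$ is in the positive cone for some $\delta>0$), but $h\notin M_2(\mathcal S_1\otimes_{\max}\mathcal S_1)_+$. 3. $M_n(\mathcal S_1\otimes_{\min}\mathcal S_1)_+=M_n(\mathcal S_1\otimes_{c}\mathcal S_1)_+$ for every $n$, that is, $\mathcal S_1\otimes_{\min}\mathcal S_1=\mathcal S_1\otimes_{c}\mathcal S_1$. Consequently $\mathcal S_1\otimes_{c}\mathcal S_1\neq\mathcal S_1\otimes_{\max}\mathcal S_1$, that is, the cones of c and max differ for some $n$. -/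

import Mathlib

open scoped TensorProduct ComplexOrder ComplexConjugate

noncomputable section

namespace OpSysTensor

universe u v w

/-! ### Positive operator matrices, Hilbert space tensor products and operator systems -/

/-- `X ∈ Mₙ(B(H)) = B(Hⁿ)` is a positive operator on `Hⁿ`: its quadratic form takes values in
`[0, ∞)`.  (The order on `ℂ` is `a ≤ b ↔ b - a ∈ [0, ∞)`.) -/
def IsPosMatrix {H : Type u} [NormedAddCommGroup H] [InnerProductSpace ℂ H] {n : ℕ}
    (X : Matrix (Fin n) (Fin n) (H →L[ℂ] H)) : Prop :=
  ∀ ξ : Fin n → H, 0 ≤ ∑ i, ∑ j, inner ℂ (ξ i) (X i j (ξ j))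

section HilbertTensor

variable {H : Type u} [NormedAddCommGroup H] [InnerProductSpace ℂ H]
variable {K : Type v} [NormedAddCommGroup K] [InnerProductSpace ℂ K]

variable (H K) in
/-- The Hilbert space tensor product of `H` and `K`: the completion of the algebraic one. -/
abbrev HilbertTensor : Type (max u v) := UniformSpace.Completion (H ⊗[ℂ] K)

/-- The bounded operator `x ⊗ y : ξ ⊗ η ↦ x ξ ⊗ y η` on the Hilbert space tensor product. -/
def tensorOp (x : H →L[ℂ] H) (y : K →L[ℂ] K) : HilbertTensor H K →L[ℂ] HilbertTensor H K :=
  (TensorProduct.mapL x y).completion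

theorem ext_hilbertTensor {A B : HilbertTensor H K →L[ℂ] HilbertTensor H K}
    (h : ∀ x : H ⊗[ℂ] K, A (x : HilbertTensor H K) = B (x : HilbertTensor H K)) : A = B := by
  ext x
  induction x using UniformSpace.Completion.induction_on with
  | hp => exact isClosed_eq A.continuous B.continuous
  | ih x => exact h x

theorem tensorOp_coe (x : H →L[ℂ] H) (y : K →L[ℂ] K) (ξ : H ⊗[ℂ] K) :
    tensorOp x y (ξ : HilbertTensor H K) = (TensorProduct.mapL x y ξ : HilbertTensor H K) := by
  simp [tensorOp]

/-- `(x, y) ↦ x ⊗ y` as a bilinear map. -/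
def tensorOpBilin : (H →L[ℂ] H) →ₗ[ℂ] (K →L[ℂ] K) →ₗ[ℂ]
    (HilbertTensor H K →L[ℂ] HilbertTensor H K) :=
  LinearMap.mk₂ ℂ tensorOp
    (fun x x' y => ext_hilbertTensor fun ξ => by
      rw [_root_.add_apply, tensorOp_coe, tensorOp_coe, tensorOp_coe,
        TensorProduct.mapL_add_left, _root_.add_apply,
        UniformSpace.Completion.coe_add])
    (fun c x y => ext_hilbertTensor fun ξ => by
      rw [_root_.smul_apply, tensorOp_coe, tensorOp_coe,
        TensorProduct.mapL_smul_left, _root_.smul_apply,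
        UniformSpace.Completion.coe_smul])
    (fun x y y' => ext_hilbertTensor fun ξ => by
      rw [_root_.add_apply, tensorOp_coe, tensorOp_coe, tensorOp_coe,
        TensorProduct.mapL_add_right, _root_.add_apply,
        UniformSpace.Completion.coe_add])
    (fun c x y => ext_hilbertTensor fun ξ => by
      rw [_root_.smul_apply, tensorOp_coe, tensorOp_coe,
        TensorProduct.mapL_smul_right, _root_.smul_apply,
        UniformSpace.Completion.coe_smul])

end HilbertTensor

/-- An operator system: a subspace of `B(H)` containing the identity and closed under adjoints. -/
structure OperatorSystem (H : Type u) [NormedAddCommGroup H] [InnerProductSpace ℂ H]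
    [CompleteSpace H] where
  toSubmodule : Submodule ℂ (H →L[ℂ] H)
  one_mem : 1 ∈ toSubmodule
  star_mem : ∀ x ∈ toSubmodule, star x ∈ toSubmodule

section Systems

variable {H : Type u} [NormedAddCommGroup H] [InnerProductSpace ℂ H] [CompleteSpace H]
variable {K : Type v} [NormedAddCommGroup K] [InnerProductSpace ℂ K] [CompleteSpace K]

instance : CoeSort (OperatorSystem H) (Type u) := ⟨fun S => S.toSubmodule⟩

/-- The order unit `1` of an operator system. -/
def OperatorSystem.unit (S : OperatorSystem H) : S := ⟨1, S.one_mem⟩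

/-- The cone `Mₙ(S)₊`. -/
def OperatorSystem.cone (S : OperatorSystem H) (n : ℕ) : Set (Matrix (Fin n) (Fin n) S) :=
  {P | IsPosMatrix (P.map fun s => (s : H →L[ℂ] H))}

/-- Complete positivity of a linear map `S → B(L)`. -/
def IsCompletelyPositive (S : OperatorSystem H) {L : Type w} [NormedAddCommGroup L]
    [InnerProductSpace ℂ L] (φ : S →ₗ[ℂ] (L →L[ℂ] L)) : Prop :=
  ∀ n : ℕ, ∀ P ∈ S.cone n, IsPosMatrix (P.map φ)

/-! ### The tensor products min, c and max

Each is given by its family of cones in `Mₙ(S ⊗ T)`, `n ∈ ℕ`. -/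

/-- The matrix order unit `1ₙ = diag(1 ⊗ 1, …, 1 ⊗ 1)` of `Mₙ(S ⊗ T)`. -/
def matrixUnit (S : OperatorSystem H) (T : OperatorSystem K) (n : ℕ) :
    Matrix (Fin n) (Fin n) (S ⊗[ℂ] T) :=
  Matrix.diagonal fun _ => S.unit ⊗ₜ[ℂ] T.unit

/-- The natural map `S ⊗ T → B(H ⊗ K)`. -/
def spatialMap (S : OperatorSystem H) (T : OperatorSystem K) :
    S ⊗[ℂ] T →ₗ[ℂ] (HilbertTensor H K →L[ℂ] HilbertTensor H K) :=
  TensorProduct.lift (tensorOpBilin.compl₁₂ S.toSubmodule.subtype T.toSubmodule.subtype)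

/-- The cones `Mₙ(S ⊗_min T)₊`. -/
def minCone (S : OperatorSystem H) (T : OperatorSystem K) (n : ℕ) :
    Set (Matrix (Fin n) (Fin n) (S ⊗[ℂ] T)) :=
  {X | IsPosMatrix (X.map (spatialMap S T))}

/-- The linear map `φ · ψ : S ⊗ T → B(L)`, `s ⊗ t ↦ φ(s) ψ(t)`. -/
def mulMap {S : OperatorSystem H} {T : OperatorSystem K} {L : Type w} [NormedAddCommGroup L]
    [InnerProductSpace ℂ L] (φ : S →ₗ[ℂ] (L →L[ℂ] L)) (ψ : T →ₗ[ℂ] (L →L[ℂ] L)) :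
    S ⊗[ℂ] T →ₗ[ℂ] (L →L[ℂ] L) :=
  TensorProduct.lift ((LinearMap.mul ℂ (L →L[ℂ] L)).compl₁₂ φ ψ)

/-- The matrix `A* (P ⊗ Q) A ∈ Mₙ(S ⊗ T)`, for `P ∈ M_k(S)`, `Q ∈ M_m(T)` and a scalar
`km × n` matrix `A`. -/
def compress {S : OperatorSystem H} {T : OperatorSystem K} {k m n : ℕ}
    (A : Matrix (Fin k × Fin m) (Fin n) ℂ) (P : Matrix (Fin k) (Fin k) S)
    (Q : Matrix (Fin m) (Fin m) T) : Matrix (Fin n) (Fin n) (S ⊗[ℂ] T) :=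
  Matrix.of fun i j => ∑ p : Fin k × Fin m, ∑ q : Fin k × Fin m,
    (conj (A p i) * A q j) • (P p.1 q.1 ⊗ₜ[ℂ] Q p.2 q.2)

/-- The cones `Dₙ = {A* (P ⊗ Q) A : P ∈ M_k(S)₊, Q ∈ M_m(T)₊}`. -/
def preMaxCone (S : OperatorSystem H) (T : OperatorSystem K) (n : ℕ) :
    Set (Matrix (Fin n) (Fin n) (S ⊗[ℂ] T)) :=
  {X | ∃ (k m : ℕ) (A : Matrix (Fin k × Fin m) (Fin n) ℂ), ∃ P ∈ S.cone k, ∃ Q ∈ T.cone m,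
    X = compress A P Q}

/-- The cones `Mₙ(S ⊗_max T)₊`: the Archimedeanization of the family `(Dₙ)`. -/
def maxCone (S : OperatorSystem H) (T : OperatorSystem K) (n : ℕ) :
    Set (Matrix (Fin n) (Fin n) (S ⊗[ℂ] T)) :=
  {X | ∀ ε : ℝ, 0 < ε → (ε : ℂ) • matrixUnit S T n + X ∈ preMaxCone S T n}

/-- `X` is strictly positive for a family of cones on `S ⊗ T`: `X - δ 1` lies in the cone for some
`δ > 0`. -/
def IsStrictlyPos {S : OperatorSystem H} {T : OperatorSystem K}
    (C : ∀ n : ℕ, Set (Matrix (Fin n) (Fin n) (S ⊗[ℂ] T))) {n : ℕ}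
    (X : Matrix (Fin n) (Fin n) (S ⊗[ℂ] T)) : Prop :=
  ∃ δ : ℝ, 0 < δ ∧ X - (δ : ℂ) • matrixUnit S T n ∈ C n

end Systems

/-- The cones `Mₙ(S ⊗_c T)₊`: those `X` for which `(φ · ψ)⁽ⁿ⁾(X)` is positive for all completely
positive maps `φ : S → B(L)`, `ψ : T → B(L)` with commuting ranges, `L` any Hilbert space. -/
def commCone.{a, b, c} {H : Type a} [NormedAddCommGroup H] [InnerProductSpace ℂ H]
    [CompleteSpace H] {K : Type b} [NormedAddCommGroup K] [InnerProductSpace ℂ K] [CompleteSpace K]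
    (S : OperatorSystem H) (T : OperatorSystem K) (n : ℕ) :
    Set (Matrix (Fin n) (Fin n) (S ⊗[ℂ] T)) :=
  {X | ∀ (L : Type c) [NormedAddCommGroup L] [InnerProductSpace ℂ L] [CompleteSpace L]
    (φ : S →ₗ[ℂ] (L →L[ℂ] L)) (ψ : T →ₗ[ℂ] (L →L[ℂ] L)),
    IsCompletelyPositive S φ → IsCompletelyPositive T ψ → (∀ s t, Commute (φ s) (ψ t)) →
    IsPosMatrix (X.map (mulMap φ ψ))}

/-- `φ : V → W` is `n`-positive with respect to families of cones `C` in `Mₙ(V)` and `D` in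
`Mₙ(W)`; positive means `1`-positive. -/
def IsNPositive {V : Type u} {W : Type v} [AddCommGroup V] [Module ℂ V] [AddCommGroup W]
    [Module ℂ W] (n : ℕ) (C : ∀ n : ℕ, Set (Matrix (Fin n) (Fin n) V))
    (D : ∀ n : ℕ, Set (Matrix (Fin n) (Fin n) W)) (φ : V →ₗ[ℂ] W) : Prop :=
  ∀ X ∈ C n, X.map φ ∈ D n

/-! ### The full group C*-algebra of a discrete group -/

theorem lpDiag_memlp {ι : Type u} {E : Type v} [NormedAddCommGroup E] [InnerProductSpace ℂ E]
    (T : ι → E →L[ℂ] E) (hT : ∀ i x, ‖T i x‖ ≤ ‖x‖) (ξ : lp (fun _ : ι => E) 2) :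
    Memℓp (fun i => T i (ξ i)) 2 :=
  Memℓp.mono' (E := fun _ : ι => E) (F := fun _ : ι => E) (lp.memℓp ξ) fun i => hT i (ξ i)

/-- The diagonal operator `⨁_i T_i` on the Hilbert space direct sum `⨁_i E`, for a family of
contractions `T_i`. -/
def lpDiag {ι : Type u} {E : Type v} [NormedAddCommGroup E] [InnerProductSpace ℂ E]
    (T : ι → E →L[ℂ] E) (hT : ∀ i x, ‖T i x‖ ≤ ‖x‖) :
    lp (fun _ : ι => E) 2 →L[ℂ] lp (fun _ : ι => E) 2 :=
  LinearMap.mkContinuous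
    (σ := RingHom.id ℂ)
    { toFun := fun ξ => (⟨fun i => T i (ξ i), lpDiag_memlp T hT ξ⟩ : lp (fun _ : ι => E) 2)
      map_add' := fun ξ η => by
        ext i : 2
        exact map_add (T i) (ξ i) (η i)
      map_smul' := fun c ξ => by
        ext i : 2
        exact map_smul (T i) c (ξ i) }
    1 (fun ξ => by
      rw [one_mul]
      exact lp.norm_mono (by norm_num) fun i => hT i (ξ i))

section Group

variable (G : Type u) [Group G]

/-- The Hilbert space `ℓ²(G × ℕ)`.  It is large enough to carry (up to unitary equivalence, after
adding a trivial summand) every cyclic unitary representation of `G`. -/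
def RepSpace : Type u := lp (fun _ : G × ℕ => ℂ) 2

instance : NormedAddCommGroup (RepSpace G) :=
  inferInstanceAs (NormedAddCommGroup (lp (fun _ : G × ℕ => ℂ) 2))
instance : InnerProductSpace ℂ (RepSpace G) :=
  inferInstanceAs (InnerProductSpace ℂ (lp (fun _ : G × ℕ => ℂ) 2))
instance : CompleteSpace (RepSpace G) :=
  inferInstanceAs (CompleteSpace (lp (fun _ : G × ℕ => ℂ) 2))

/-- The unitary representations of `G` on `RepSpace G`. -/
abbrev UnitaryRep : Type u := G →* unitary (RepSpace G →L[ℂ] RepSpace G)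

/-- The space of the universal representation, the Hilbert space direct sum `⨁_π RepSpace G`. -/
def UnivSpace : Type u := lp (fun _ : UnitaryRep G => RepSpace G) 2

instance : NormedAddCommGroup (UnivSpace G) :=
  inferInstanceAs (NormedAddCommGroup (lp (fun _ : UnitaryRep G => RepSpace G) 2))
instance : InnerProductSpace ℂ (UnivSpace G) :=
  inferInstanceAs (InnerProductSpace ℂ (lp (fun _ : UnitaryRep G => RepSpace G) 2))
instance : CompleteSpace (UnivSpace G) :=
  inferInstanceAs (CompleteSpace (lp (fun _ : UnitaryRep G => RepSpace G) 2))

variable {G}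

/-- The universal representation `g ↦ ⨁_π π(g)`. -/
def univRep (g : G) : UnivSpace G →L[ℂ] UnivSpace G :=
  lpDiag (fun π : UnitaryRep G => (π g : RepSpace G →L[ℂ] RepSpace G))
    fun π x => (ContinuousLinearMap.norm_map_of_mem_unitary (π g).2 x).le

variable (G) in
/-- The full group C*-algebra `C*(G)`: the norm closed *-subalgebra generated by the image of the
universal representation. -/
def groupCStar : StarSubalgebra ℂ (UnivSpace G →L[ℂ] UnivSpace G) :=
  (StarAlgebra.adjoin ℂ (Set.range (univRep (G := G)))).topologicalClosure

/-- The operator system `span {1, u, u* : u ∈ 𝔲}` of a set `𝔲` of generators of `G`, as a subspace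
of `C*(G) ⊆ B(UnivSpace G)`. -/
def groupOpSys (gens : Set G) : OperatorSystem (UnivSpace G) where
  toSubmodule := Submodule.span ℂ
    ({1} ∪ univRep '' gens ∪ (fun g => star (univRep g)) '' gens)
  one_mem := Submodule.subset_span (by simp)
  star_mem := fun x hx => by
    induction hx using Submodule.span_induction with
    | mem x hx =>
      rcases hx with (hx | ⟨g, hg, rfl⟩) | ⟨g, hg, rfl⟩
      · rw [Set.mem_singleton_iff.1 hx, star_one]
        exact Submodule.subset_span (by simp)
      · exact Submodule.subset_span (Or.inr ⟨g, hg, rfl⟩)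
      · rw [star_star]
        exact Submodule.subset_span (Or.inl (Or.inr ⟨g, hg, rfl⟩))
    | zero => simp
    | add x y _ _ hx hy => rw [star_add]; exact Submodule.add_mem _ hx hy
    | smul c x _ hx => rw [star_smul]; exact Submodule.smul_mem _ _ hx

theorem univRep_mem (g : G) : univRep g ∈ groupCStar G :=
  StarSubalgebra.le_topologicalClosure _ (StarAlgebra.subset_adjoin ℂ _ ⟨g, rfl⟩)

theorem groupOpSys_le (gens : Set G) {x : UnivSpace G →L[ℂ] UnivSpace G}
    (hx : x ∈ (groupOpSys gens).toSubmodule) : x ∈ groupCStar G := by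
  have h : (groupOpSys gens).toSubmodule ≤ (groupCStar G).toSubalgebra.toSubmodule := by
    refine Submodule.span_le.2 ?_
    rintro x ((hx | ⟨g, -, rfl⟩) | ⟨g, -, rfl⟩)
    · rw [Set.mem_singleton_iff.1 hx]
      exact one_mem (groupCStar G)
    · exact univRep_mem g
    · exact (star_mem (univRep_mem g) : star (univRep g) ∈ groupCStar G)
  exact h hx

end Group

/-! ### The operator system `S₁` of the free group on one generator -/

/-- The free group `𝔽₁`. -/
abbrev F1 : Type := FreeGroup (Fin 1)

/-- `S₁ = span {1, u, u*} ⊆ C*(𝔽₁)`. -/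
def S1 : OperatorSystem (UnivSpace F1) := groupOpSys {FreeGroup.of 0}

/-- The generator `u` as an element of `S₁`. -/
def genU : S1 :=
  ⟨univRep (FreeGroup.of 0), Submodule.subset_span (Or.inl (Or.inr ⟨_, rfl, rfl⟩))⟩

/-- The element `u*` of `S₁`. -/
def genUStar : S1 := ⟨star (genU : UnivSpace F1 →L[ℂ] UnivSpace F1), S1.star_mem _ genU.2⟩

/-- The inclusion `S₁ ⊆ C*(𝔽₁)`. -/
def inclS1 (s : S1) : groupCStar F1 := ⟨s, groupOpSys_le _ s.2⟩

/-- Evaluation at `z ∈ 𝕋` of elements of `S₁`, through an identification `C*(𝔽₁) ≅ C(𝕋)`. -/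
def evalS1 (Φ : groupCStar F1 ≃⋆ₐ[ℂ] C(Circle, ℂ)) (z : Circle) : S1 →ₗ[ℂ] ℂ where
  toFun := fun s => Φ (inclS1 s) z
  map_add' := fun s t => by
    rw [show inclS1 (s + t) = inclS1 s + inclS1 t from rfl, map_add]; rfl
  map_smul' := fun c s => by
    rw [show inclS1 (c • s) = c • inclS1 s from rfl, map_smul]; rfl

/-- Evaluation at `(z, w) ∈ 𝕋²` of elements of `S₁ ⊗ S₁`, seen as functions on the torus through an
identification `C*(𝔽₁) ≅ C(𝕋)`: `(s ⊗ t)(z, w) = s(z) t(w)`. -/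
def evalTorus (Φ : groupCStar F1 ≃⋆ₐ[ℂ] C(Circle, ℂ)) (z w : Circle) :
    S1 ⊗[ℂ] S1 →ₗ[ℂ] ℂ :=
  TensorProduct.lift ((LinearMap.mul ℂ ℂ).compl₁₂ (evalS1 Φ z) (evalS1 Φ w))

/-- The matrix function `h(z, w)` on the torus. -/
def hTorus (z w : Circle) : Matrix (Fin 2) (Fin 2) ℂ :=
  !![3 + 2 * (((z * w : ℂ).re : ℝ) : ℂ), 2 * conj (z : ℂ) * w;
     2 * z * conj (w : ℂ), 3 - 2 * (((z * w : ℂ).re : ℝ) : ℂ)]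

/-- The matrix `h` as an element of `M₂(S₁ ⊗ S₁)`; here `z = u ⊗ 1` and `w = 1 ⊗ u`, so that
`2 Re(zw) = u ⊗ u + u* ⊗ u*`. -/
def hMat : Matrix (Fin 2) (Fin 2) (S1 ⊗[ℂ] S1) :=
  !![(3 : ℂ) • (S1.unit ⊗ₜ[ℂ] S1.unit) + (genU ⊗ₜ[ℂ] genU + genUStar ⊗ₜ[ℂ] genUStar),
      (2 : ℂ) • (genUStar ⊗ₜ[ℂ] genU);
     (2 : ℂ) • (genU ⊗ₜ[ℂ] genUStar),
      (3 : ℂ) • (S1.unit ⊗ₜ[ℂ] S1.unit) - (genU ⊗ₜ[ℂ] genU + genUStar ⊗ₜ[ℂ] genUStar)]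

end OpSysTensor

end

open OpSysTensor

universe w

/-!
The cones min and c of `S₁ ⊗ S₁` both turn out to be `torusCone`, the matrices that are positive
semidefinite at every point of the torus, and the max cone is compared with that.

The generator `u` of `C*(𝔽₁)` has an eigenvector for every `z ∈ 𝕋` (`univRep_eigVec`), which gives
both the evaluations `ev z` and the spectrum of `u`, hence `C*(𝔽₁) ≅ C(𝕋)`. Testing on eigenvectors
shows that min and c positive matrices are positive on the torus.

The converse (`isPosMatrix_mulMap`) is an operator-valued quadrature. If `[A, B; B*, A] ≥ 0`, the
Poisson kernel of `(A + ε)^(-1/2) B (A + ε)^(-1/2)`, rescaled and sampled at roots of unity, gives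
positive operators `P_ω` that commute with everything commuting with `A`, `B` and `B*`, with
`∑ P_ω → A + ε` and `∑ ω P_ω → B`. For commuting completely positive maps `φ`, `ψ` on `S₁`, with
weights `P_ω` and `Q_η`, the image of `X` under `φ · ψ` is thus a limit of sums of
`X(ω, η) ⊗ P_ω Q_η`, and `P_ω Q_η` is positive as a product of commuting positive operators. The
spatial embedding of `S₁ ⊗ S₁` is itself of the form `φ · ψ`, so one argument serves min and c.

At the first matrix level, a scalar function `a(z) + b(z) w + c(z) w̄` that is nonnegative on the
torus satisfies `2 |b| ≤ a`, that is, `[a/2, b; c, a/2] ∈ M₂(S₁)₊`. Pairing this matrix with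
`[1, u; u*, 1]` puts the function into `D₁` (`torusCone_one_subset_preMaxCone`).

At the second level, `h` is separated from the max cone by a functional. A map `Θ : S₁ ⊗ S₁ → M₂`
whose `8 × 8` block Toeplitz matrix of values on the monomials is positive pairs nonnegatively with
`D₂`: apply the complete positivity of block positive maps on `S₁` first in the left and then in the
right tensor factor. The choice in `witness` takes the value `2 ε - 2` at `ε 1₂ + h`.
-/

namespace OpSysTensor

open Filter Topology

/-! ### Poisson kernels and quadrature on roots of unity -/

section Poisson

variable {A : Type*} [CStarAlgebra A]

/-- For `z ^ N = 1` this is the resolvent `(1 - z̄ T)⁻¹`, written as a geometric sum of length `N`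
times a factor that does not depend on `z`, which makes averages over `z` computable. -/
noncomputable def resolventSum (T : A) (N : ℕ) (z : Circle) : A :=
  (∑ k ∈ Finset.range N, (conj (z : ℂ) • T) ^ k) * Ring.inverse (1 - T ^ N)

theorem isUnit_one_sub_pow {T : A} (hT : ‖T‖ < 1) {N : ℕ} (hN : N ≠ 0) : IsUnit (1 - T ^ N) := by
  apply isUnit_one_sub_of_norm_lt_one
  calc ‖T ^ N‖ ≤ ‖T‖ ^ N := norm_pow_le' _ (Nat.pos_of_ne_zero hN)
    _ < 1 := pow_lt_one₀ (norm_nonneg _) hT hN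

theorem one_sub_mul_resolventSum {T : A} (hT : ‖T‖ < 1) {N : ℕ} (hN : N ≠ 0) {z : Circle}
    (hz : z ^ N = 1) : (1 - conj (z : ℂ) • T) * resolventSum T N z = 1 := by
  have h1 : (1 - conj (z : ℂ) • T) * ∑ k ∈ Finset.range N, (conj (z : ℂ) • T) ^ k = 1 - T ^ N := by
    rw [mul_neg_geom_sum, smul_pow, ← map_pow, ← Circle.coe_pow, hz]
    simp
  rw [resolventSum, ← mul_assoc, h1, Ring.mul_inverse_cancel _ (isUnit_one_sub_pow hT hN)]

/-- The operator Poisson kernel `(1 - z̄ T)⁻¹ + ((1 - z̄ T)⁻¹)* - 1` at an `N`-th root of unity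
`z`. -/
noncomputable def poissonKernel (T : A) (N : ℕ) (z : Circle) : A :=
  resolventSum T N z + star (resolventSum T N z) - 1

/-- With `D = (1 - z̄ T)⁻¹` the kernel equals `D* (1 - T* T) D`. -/
theorem poissonKernel_nonneg [PartialOrder A] [StarOrderedRing A] {T : A} (hT : ‖T‖ < 1) {N : ℕ}
    (hN : N ≠ 0) {z : Circle} (hz : z ^ N = 1) : 0 ≤ poissonKernel T N z := by
  have h := one_sub_mul_resolventSum hT hN hz
  set D := resolventSum T N z
  set E := conj (z : ℂ) • T with hE
  have hED : E * D = D - 1 := by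
    rw [sub_mul, one_mul] at h
    rw [← h]; abel
  have key : poissonKernel T N z = star D * (1 - star T * T) * D := by
    -- `E = z̄ T` has the same modulus as `T`, and `E D = D - 1`
    have hEE : star T * T = star E * E := by
      rw [hE, star_smul, smul_mul_smul_comm]
      have : star (conj (z : ℂ)) * conj (z : ℂ) = 1 := by
        simp [Complex.mul_conj]
      rw [this, one_smul]
    have : star D * (star E * E) * D = star (E * D) * (E * D) := by
      simp only [star_mul, mul_assoc]
    rw [mul_sub, sub_mul, hEE, this, hED, poissonKernel]
    simp only [star_sub, star_one, mul_sub, sub_mul, mul_one, one_mul]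
    abel
  rw [key]
  refine star_left_conjugate_nonneg ?_ D
  rw [sub_nonneg]
  have h2 : ‖star T * T‖ ≤ 1 := by
    rw [CStarRing.norm_star_mul_self]
    nlinarith [norm_nonneg T]
  exact (CStarAlgebra.norm_le_one_iff_of_nonneg _ (star_mul_self_nonneg T)).1 h2

/-- Averaging over the roots of unity extracts one term of the geometric sum, by orthogonality of
characters of `ZMod N`. -/
theorem sum_toCircle_smul_resolventSum (T : A) (N : ℕ) [NeZero N] {m : ℕ} (hm : m < N) :
    ∑ j : ZMod N, (ZMod.toCircle (j * (m : ZMod N)) : ℂ) • resolventSum T N (ZMod.toCircle j) =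
      (N : ℂ) • (T ^ m * Ring.inverse (1 - T ^ N)) := by
  have h1 : ∀ j : ZMod N,
      (ZMod.toCircle (j * (m : ZMod N)) : ℂ) • resolventSum T N (ZMod.toCircle j) =
      (∑ k ∈ Finset.range N, (ZMod.stdAddChar (j * ((m : ZMod N) - (k : ZMod N)))) • T ^ k) *
        Ring.inverse (1 - T ^ N) := by
    intro j
    rw [resolventSum, ← smul_mul_assoc, Finset.smul_sum]
    congr 1
    refine Finset.sum_congr rfl fun k _ => ?_
    rw [smul_pow, smul_smul]
    congr 1
    rw [← Circle.coe_inv_eq_conj, ← Circle.coe_pow, ← AddChar.map_neg_eq_inv,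
      ← AddChar.map_nsmul_eq_pow, ← Circle.coe_mul, ← AddChar.map_add_eq_mul,
      ZMod.stdAddChar_apply]
    congr 2
    simp only [nsmul_eq_mul]
    ring
  simp_rw [h1]
  rw [← Finset.sum_mul, Finset.sum_comm, ← smul_mul_assoc]
  congr 1
  simp_rw [← Finset.sum_smul, AddChar.sum_mulShift _ (ZMod.isPrimitive_stdAddChar N)]
  rw [Finset.sum_eq_single m]
  · simp
  · intro k hk hkm
    rw [if_neg, Nat.cast_zero, zero_smul]
    rw [sub_eq_zero, ZMod.natCast_eq_natCast_iff', Nat.mod_eq_of_lt hm,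
      Nat.mod_eq_of_lt (Finset.mem_range.1 hk)]
    exact fun h => hkm h.symm
  · intro h
    exact absurd (Finset.mem_range.2 hm) h

theorem sum_poissonKernel (T : A) (N : ℕ) [NeZero N] :
    ∑ j : ZMod N, poissonKernel T N (ZMod.toCircle j) =
      (N : ℂ) • (Ring.inverse (1 - T ^ N) + star (Ring.inverse (1 - T ^ N)) - 1) := by
  have h := sum_toCircle_smul_resolventSum T N (m := 0) (Nat.pos_of_ne_zero (NeZero.ne N))
  simp only [Nat.cast_zero, mul_zero, AddChar.map_zero_eq_one, Circle.coe_one, one_smul, pow_zero,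
    one_mul] at h
  simp only [poissonKernel, Finset.sum_sub_distrib, Finset.sum_add_distrib, ← star_sum, h]
  simp only [star_smul, Finset.sum_const, Finset.card_univ, ZMod.card, smul_sub, smul_add,
    Nat.cast_smul_eq_nsmul, star_trivial]

theorem sum_toCircle_smul_poissonKernel (T : A) (N : ℕ) [NeZero N] (hN : 1 < N) :
    ∑ j : ZMod N, (ZMod.toCircle j : ℂ) • poissonKernel T N (ZMod.toCircle j) =
      (N : ℂ) • (T * Ring.inverse (1 - T ^ N) +
        star (T ^ (N - 1) * Ring.inverse (1 - T ^ N))) := by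
  have h1 := sum_toCircle_smul_resolventSum T N hN
  have h2 := congrArg star (sum_toCircle_smul_resolventSum T N (m := N - 1) (by omega))
  have h3 : ∑ j : ZMod N, (ZMod.toCircle j : ℂ) = 0 := by
    have := AddChar.sum_mulShift (1 : ZMod N) (ZMod.isPrimitive_stdAddChar N)
    have h10 : (1 : ZMod N) ≠ 0 := by
      have : Fact (1 < N) := ⟨hN⟩
      exact one_ne_zero
    simpa [ZMod.stdAddChar_apply, h10] using this
  have h4 : ∀ j : ZMod N, star ((ZMod.toCircle (j * ((N - 1 : ℕ) : ZMod N)) : ℂ)) =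
      ZMod.toCircle j := by
    intro j
    rw [Nat.cast_sub hN.le]
    simp [AddChar.map_neg_eq_inv, ← Circle.coe_inv_eq_conj]
  simp only [star_sum, star_smul, h4] at h2
  simp only [Nat.cast_one, mul_one, pow_one] at h1
  simp only [poissonKernel, smul_sub, smul_add, Finset.sum_sub_distrib, Finset.sum_add_distrib, h1,
    h2, ← Finset.sum_smul, h3]
  simp

theorem tendsto_inverse_one_sub_pow {T : A} (hT : ‖T‖ < 1) :
    Tendsto (fun N : ℕ => Ring.inverse (1 - T ^ N)) atTop (𝓝 1) := by
  have h1 : Tendsto (fun N : ℕ => 1 - T ^ N) atTop (𝓝 (1 - 0)) :=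
    tendsto_const_nhds.sub (tendsto_pow_atTop_nhds_zero_of_norm_lt_one hT)
  rw [sub_zero] at h1
  have h2 := (NormedRing.inverse_continuousAt (1 : Aˣ)).tendsto
  simp only [Units.val_one, Ring.inverse_one] at h2
  exact h2.comp h1

theorem commute_ringInverse {R : Type*} [MonoidWithZero R] {a b : R} (h : Commute a b) :
    Commute a (Ring.inverse b) := by
  by_cases hb : IsUnit b
  · obtain ⟨b, rfl⟩ := hb
    rw [Ring.inverse_unit]
    exact h.units_inv_right
  · rw [Ring.inverse_non_unit _ hb]
    exact Commute.zero_right a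

theorem commute_resolventSum {C T : A} (h : Commute C T) (N : ℕ) (z : Circle) :
    Commute C (resolventSum T N z) := by
  refine Commute.mul_right (Commute.sum_right _ _ _ fun k _ => ?_) ?_
  · exact (h.smul_right _).pow_right _
  · exact commute_ringInverse ((Commute.one_right C).sub_right (h.pow_right N))

theorem commute_poissonKernel {C T : A} (h : Commute C T) (h' : Commute C (star T)) (N : ℕ)
    (z : Circle) : Commute C (poissonKernel T N z) := by
  have h'' : Commute (star C) T := by simpa using h'.star_star
  refine Commute.sub_right (Commute.add_right (commute_resolventSum h N z) ?_)
    (Commute.one_right _)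
  simpa using (commute_resolventSum h'' N z).star_star

/-- A strict contraction is a limit of sums `∑ ω • P_ω` over roots of unity with positive weights
`P_ω` of total mass tending to `1`, where the weights commute with all that commutes with `T` and
`T*`. -/
theorem exists_quadrature [PartialOrder A] [StarOrderedRing A] {T : A} (hT : ‖T‖ < 1) :
    ∃ P : ∀ N : ℕ, ZMod (N + 2) → A, (∀ N j, 0 ≤ P N j) ∧
      (∀ C, Commute C T → Commute C (star T) → ∀ N j, Commute C (P N j)) ∧
      Tendsto (fun N => ∑ j, P N j) atTop (𝓝 1) ∧
      Tendsto (fun N => ∑ j, (ZMod.toCircle j : ℂ) • P N j) atTop (𝓝 T) := by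
  have hpow : ∀ (N : ℕ) (j : ZMod (N + 2)), (ZMod.toCircle j) ^ (N + 2) = 1 := by
    intro N j
    rw [← AddChar.map_nsmul_eq_pow]
    simp
  have hK := tendsto_inverse_one_sub_pow hT
  have hT0 := tendsto_pow_atTop_nhds_zero_of_norm_lt_one hT
  -- at least two nodes are needed for `∑ ω = 0`
  refine ⟨fun N j => (((N + 2 : ℕ) : ℂ)⁻¹) • poissonKernel T (N + 2) (ZMod.toCircle j), ?_, ?_, ?_,
    ?_⟩
  · intro N j
    have := poissonKernel_nonneg hT (by omega) (hpow N j)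
    have hc : (0 : ℂ) ≤ (((N + 2 : ℕ) : ℂ)⁻¹) := by positivity
    exact smul_nonneg hc this
  · intro C h h' N j
    exact (commute_poissonKernel h h' _ _).smul_right _
  · simp_rw [← Finset.smul_sum, sum_poissonKernel]
    have h1 : Tendsto (fun N : ℕ => Ring.inverse (1 - T ^ N) + star (Ring.inverse (1 - T ^ N)) - 1)
        atTop (𝓝 (1 + star 1 - 1)) := (hK.add hK.star).sub_const 1
    have h2 := (tendsto_add_atTop_iff_nat 2).2 h1
    simp only [star_one, add_sub_cancel_right] at h2
    refine h2.congr fun N => ?_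
    rw [smul_smul, inv_mul_cancel₀ (Nat.cast_ne_zero.2 (by omega)), one_smul]
  · have h1 : Tendsto (fun N : ℕ => T * Ring.inverse (1 - T ^ (N + 2)) +
        star (T ^ (N + 1) * Ring.inverse (1 - T ^ (N + 2)))) atTop (𝓝 (T * 1 + star (0 * 1))) := by
      have hK2 := (tendsto_add_atTop_iff_nat 2).2 hK
      have hT1 := (tendsto_add_atTop_iff_nat 1).2 hT0
      exact (hK2.const_mul T).add (hT1.mul hK2).star
    simp only [mul_one, star_zero, add_zero] at h1
    refine h1.congr fun N => ?_
    simp_rw [smul_comm _ ((((N + 2 : ℕ) : ℂ)⁻¹)), ← Finset.smul_sum]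
    rw [sum_toCircle_smul_poissonKernel T (N + 2) (by omega), smul_smul,
      inv_mul_cancel₀ (Nat.cast_ne_zero.2 (by omega)), one_smul]
    rfl

end Poisson

/-! ### Positive operator 2 × 2 matrices and quadrature -/

section Block
variable {L : Type*} [NormedAddCommGroup L] [InnerProductSpace ℂ L]

theorem isPosMatrix_two {A B B' A' : L →L[ℂ] L} : IsPosMatrix !![A, B; B', A'] ↔
    ∀ x y, 0 ≤ inner ℂ x (A x) + inner ℂ x (B y) + (inner ℂ y (B' x) + inner ℂ y (A' y)) := by
  constructor
  · intro h x y
    simpa [Fin.sum_univ_two] using h ![x, y]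
  · intro h ξ
    simpa [Fin.sum_univ_two] using h (ξ 0) (ξ 1)

theorem nonneg_of_isPosMatrix_two {A B B' A' : L →L[ℂ] L} (h : IsPosMatrix !![A, B; B', A']) :
    0 ≤ A := by
  rw [ContinuousLinearMap.nonneg_iff_isPositive, ContinuousLinearMap.isPositive_iff]
  have h1 : ∀ x, 0 ≤ inner ℂ x (A x) := fun x => by
    simpa using isPosMatrix_two.1 h x 0
  have h2 : ∀ x, 0 ≤ inner ℂ (A x) x := fun x => by
    have := star_nonneg_iff.2 (h1 x)
    rwa [Complex.star_def, inner_conj_symm] at this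
  have := (ContinuousLinearMap.isPositive_iff_complex A).2 fun x => by
    have := Complex.nonneg_iff.1 (h2 x)
    exact ⟨Complex.ext (by simp) (by simp [← this.2]), this.1⟩
  exact (ContinuousLinearMap.isPositive_iff A).1 this

variable [CompleteSpace L]

theorem star_eq_of_isPosMatrix_two {A B B' A' : L →L[ℂ] L} (h : IsPosMatrix !![A, B; B', A']) :
    star B = B' := by
  have hA : ∀ x, (inner ℂ x (A x)).im = 0 := fun x => by
    have := isPosMatrix_two.1 h x 0
    simp only [map_zero, inner_zero_left, inner_zero_right, add_zero] at this
    exact (Complex.nonneg_iff.1 this).2.symm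
  have hA' : ∀ y, (inner ℂ y (A' y)).im = 0 := fun y => by
    have := isPosMatrix_two.1 h 0 y
    simp only [map_zero, inner_zero_left, inner_zero_right, zero_add] at this
    exact (Complex.nonneg_iff.1 this).2.symm
  have him : ∀ x y, (inner ℂ x (B y)).im + (inner ℂ y (B' x)).im = 0 := fun x y => by
    have := (Complex.nonneg_iff.1 (isPosMatrix_two.1 h x y)).2
    simp only [Complex.add_im, hA, hA'] at this
    linarith
  rw [ContinuousLinearMap.star_eq_adjoint]
  symm
  rw [ContinuousLinearMap.eq_adjoint_iff]
  intro x y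
  rw [← inner_conj_symm]
  have h1 := him x y
  have h2 := him x (Complex.I • y)
  simp only [map_smul, inner_smul_right, inner_smul_left, Complex.mul_im, Complex.conj_I,
    Complex.I_re, Complex.I_im, Complex.neg_re, Complex.neg_im] at h2
  apply Complex.ext
  · rw [Complex.conj_re]; linarith
  · rw [Complex.conj_im]; linarith

/-- The quadrature for a positive matrix `[A, B; B*, A]`: the normalization
`(A + ε)^(-1/2) B (A + ε)^(-1/2)` is a strict contraction, and its weights are rescaled. -/
theorem exists_quadrature_of_isPosMatrix {A B B' : L →L[ℂ] L} (h : IsPosMatrix !![A, B; B', A])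
    {ε : ℝ} (hε : 0 < ε) :
    ∃ P : ∀ N : ℕ, ZMod (N + 2) → (L →L[ℂ] L), (∀ N j, 0 ≤ P N j) ∧
      (∀ C, Commute C A → Commute C B → Commute C B' → ∀ N j, Commute C (P N j)) ∧
      Tendsto (fun N => ∑ j, P N j) atTop (𝓝 (A + (ε : ℂ) • 1)) ∧
      Tendsto (fun N => ∑ j, (ZMod.toCircle j : ℂ) • P N j) atTop (𝓝 B) ∧
      Tendsto (fun N => ∑ j, conj (ZMod.toCircle j : ℂ) • P N j) atTop (𝓝 B') := by
  have hA := nonneg_of_isPosMatrix_two h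
  have hB := star_eq_of_isPosMatrix_two h
  set A₁ : L →L[ℂ] L := A + (ε : ℂ) • 1 with hA₁
  have hε1 : IsStrictlyPositive ((ε : ℂ) • (1 : L →L[ℂ] L)) := by
    have h0 : (0 : L →L[ℂ] L) ≤ (ε : ℂ) • 1 :=
      smul_nonneg (by exact_mod_cast hε.le) zero_le_one
    refine IsUnit.isStrictlyPositive ?_ h0
    exact (isUnit_one).smul (Units.mk0 (ε : ℂ) (by exact_mod_cast hε.ne'))
  have hA₁pos : IsStrictlyPositive A₁ := hε1.nonneg_add hA
  set S := CFC.sqrt A₁ with hS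
  have hS2 : S * S = A₁ := CFC.sqrt_mul_sqrt_self A₁ hA₁pos.nonneg
  have hSu : IsUnit S := hA₁pos.isUnit_cfcSqrt
  have hSs : star S = S := (CFC.sqrt_nonneg A₁).isSelfAdjoint
  set R := Ring.inverse S with hR
  have hSR : S * R = 1 := Ring.mul_inverse_cancel _ hSu
  have hRS : R * S = 1 := Ring.inverse_mul_cancel _ hSu
  have hRs : star R = R := by
    have : star R * S = 1 := by rw [← hSs, ← star_mul, hSR, star_one]
    calc star R = star R * (S * R) := by rw [hSR, mul_one]
      _ = R := by rw [← mul_assoc, this, one_mul]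
  set T := R * B * R with hT
  have hTs : star T = R * B' * R := by simp [hT, hRs, hB, mul_assoc]
  have hSTS : S * T * S = B := by
    calc S * T * S = (S * R) * B * (R * S) := by simp only [hT, mul_assoc]
      _ = B := by rw [hSR, hRS, one_mul, mul_one]
  have hRAR : R * A * R = 1 - (ε : ℂ) • (R * R) := by
    have : R * A₁ * R = 1 := by
      calc R * A₁ * R = (R * S) * (S * R) := by rw [← hS2]; simp only [mul_assoc]
        _ = 1 := by rw [hSR, hRS, one_mul]
    rw [eq_sub_iff_add_eq, ← this, hA₁, mul_add, add_mul]
    simp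
  have hRin : ∀ (X : L →L[ℂ] L) (x y : L), inner ℂ (R x) (X (R y)) = inner ℂ x ((R * X * R) y) := by
    intro X x y
    have := ContinuousLinearMap.adjoint_inner_left R (X (R y)) x
    rw [← ContinuousLinearMap.star_eq_adjoint, hRs] at this
    exact this
  have hTnorm : ‖T‖ < 1 := by
    have key : ∀ y, ‖T y‖ ^ 2 + ε * ‖R y‖ ^ 2 ≤ ‖y‖ ^ 2 := by
      intro y
      -- the vector that minimizes the quadratic form of `[1, T; T*, 1]` for fixed `y`
      have h1 := (Complex.nonneg_iff.1 (isPosMatrix_two.1 h (R (-(T y))) (R y))).1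
      simp only [hRin, hRAR, ← hTs] at h1
      have hRR : ∀ x, inner ℂ x ((R * R) x) = ((‖R x‖ ^ 2 : ℝ) : ℂ) := by
        intro x
        have := hRin 1 x x
        rw [mul_one] at this
        rw [← this]
        change inner ℂ (R x) (R x) = _
        rw [inner_self_eq_norm_sq_to_K]
        norm_cast
      have hTy : inner ℂ y ((star T) (-(T y))) = -((‖T y‖ ^ 2 : ℝ) : ℂ) := by
        rw [ContinuousLinearMap.star_eq_adjoint, ContinuousLinearMap.adjoint_inner_right,
          inner_neg_right, inner_self_eq_norm_sq_to_K]
        norm_cast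
      have hTT : inner ℂ (T y) (T y) = ((‖T y‖ ^ 2 : ℝ) : ℂ) := by
        rw [inner_self_eq_norm_sq_to_K]; norm_cast
      have hyy : inner ℂ y y = ((‖y‖ ^ 2 : ℝ) : ℂ) := by
        rw [inner_self_eq_norm_sq_to_K]; norm_cast
      rw [← hT, hTy] at h1
      simp only [_root_.sub_apply, _root_.smul_apply, inner_sub_right, inner_smul_right, hRR,
        inner_neg_left, inner_neg_right, hTT, ← Complex.ofReal_mul, one_apply_eq_self,
        hyy, map_neg, mul_neg, Complex.add_re, Complex.sub_re, Complex.neg_re,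
        Complex.ofReal_re] at h1
      nlinarith [mul_nonneg hε.le (sq_nonneg ‖R (T y)‖)]
    -- `‖y‖ ≤ ‖S‖ ‖R y‖` turns the strict positivity into a bound on `‖T‖` below `1`
    have hSy : ∀ y, ‖y‖ ≤ ‖S‖ * ‖R y‖ := fun y => by
      calc ‖y‖ = ‖S (R y)‖ := by
            rw [show S (R y) = (S * R) y from rfl, hSR]; rfl
        _ ≤ _ := S.le_opNorm _
    set c : ℝ := ‖S‖ ^ 2 / (‖S‖ ^ 2 + ε) with hc
    have hd : 0 < ‖S‖ ^ 2 + ε := by positivity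
    have hc1 : c < 1 := by rw [hc, div_lt_one hd]; linarith
    have hc0 : 0 ≤ c := by positivity
    refine lt_of_le_of_lt (T.opNorm_le_bound (Real.sqrt_nonneg c) fun y => ?_)
      ((Real.sqrt_lt' one_pos).2 (by rwa [one_pow]))
    rw [← Real.sqrt_sq (norm_nonneg y), ← Real.sqrt_mul hc0]
    refine Real.le_sqrt_of_sq_le ?_
    have h2 : ‖y‖ ^ 2 ≤ ‖S‖ ^ 2 * ‖R y‖ ^ 2 := by
      rw [← mul_pow]; exact pow_le_pow_left₀ (norm_nonneg y) (hSy y) 2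
    rw [hc, div_mul_eq_mul_div, le_div_iff₀ hd]
    nlinarith [mul_le_mul_of_nonneg_left (key y) (sq_nonneg ‖S‖),
      mul_le_mul_of_nonneg_left h2 hε.le,
      mul_le_mul_of_nonneg_left (key y) hε.le,
      mul_nonneg hε.le (mul_nonneg hε.le (sq_nonneg ‖R y‖))]
  obtain ⟨P, hP0, hPc, hP1, hP2⟩ := exists_quadrature hTnorm
  refine ⟨fun N j => S * P N j * S, ?_, ?_, ?_, ?_, ?_⟩
  · intro N j
    have := star_left_conjugate_nonneg (hP0 N j) S
    rwa [hSs] at this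
  · intro C hCA hCB hCB' N j
    have hCA₁ : Commute C A₁ := hCA.add_right ((Commute.one_right C).smul_right _)
    have hCS : Commute C S := by
      exact ((hCA₁.symm.cfcₙ_nnreal NNReal.sqrt)).symm
    have hCR : Commute C R := commute_ringInverse hCS
    refine (hCS.mul_right (hPc C ((hCR.mul_right hCB).mul_right hCR) ?_ N j)).mul_right hCS
    rw [hTs]
    exact (hCR.mul_right hCB').mul_right hCR
  · have := (hP1.const_mul S).mul_const S
    rw [mul_one, hS2] at this
    exact this.congr fun N => by rw [Finset.mul_sum, Finset.sum_mul]
  · have := (hP2.const_mul S).mul_const S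
    rw [hSTS] at this
    exact this.congr fun N => by simp [Finset.mul_sum, Finset.sum_mul]
  · have := (hP2.star.const_mul S).mul_const S
    have h3 : S * star T * S = B' := by rw [← hB, ← hSTS]; simp [hSs, mul_assoc]
    rw [h3] at this
    refine this.congr fun N => ?_
    have hs : ∀ j, star (P N j) = P N j := fun j => (hP0 N j).isSelfAdjoint
    simp [Finset.mul_sum, Finset.sum_mul, hs]

end Block

/-! ### Evaluation of `S₁` at points of the circle -/

section UnivRep
universe u
variable {G : Type u} [Group G]

theorem univRep_mul (g h : G) : univRep (g * h) = univRep g * univRep h := by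
  ext ξ
  refine lp.ext (funext fun π => ?_)
  change ((π (g * h) : unitary _) : RepSpace G →L[ℂ] RepSpace G) _ = _
  rw [map_mul]
  rfl

theorem univRep_one : univRep (1 : G) = 1 := by
  ext ξ
  refine lp.ext (funext fun π => ?_)
  change ((π 1 : unitary _) : RepSpace G →L[ℂ] RepSpace G) _ = _
  rw [map_one]
  rfl

theorem norm_univRep_le (g : G) (ξ : UnivSpace G) : ‖univRep g ξ‖ ≤ ‖ξ‖ :=
  lp.norm_mono (E := fun _ : UnitaryRep G => RepSpace G)
    (F := fun _ : UnitaryRep G => RepSpace G) (by norm_num) fun π =>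
    (ContinuousLinearMap.norm_map_of_mem_unitary (π g).2 _).le

theorem univRep_inv_mul (g : G) : univRep g⁻¹ * univRep g = 1 := by
  rw [← univRep_mul, inv_mul_cancel, univRep_one]

theorem univRep_mul_inv (g : G) : univRep g * univRep g⁻¹ = 1 := by
  rw [← univRep_mul, mul_inv_cancel, univRep_one]

theorem norm_univRep (g : G) (ξ : UnivSpace G) : ‖univRep g ξ‖ = ‖ξ‖ := by
  refine le_antisymm (norm_univRep_le g ξ) ?_
  calc ‖ξ‖ = ‖univRep g⁻¹ (univRep g ξ)‖ := by
        rw [← mul_apply_eq_comp, univRep_inv_mul, one_apply_eq_self]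
    _ ≤ _ := norm_univRep_le _ _

theorem star_univRep_mul_self (g : G) : star (univRep g) * univRep g = 1 :=
  (ContinuousLinearMap.norm_map_iff_adjoint_comp_self _).1 (norm_univRep g)

theorem star_univRep (g : G) : star (univRep g) = univRep g⁻¹ := by
  calc star (univRep g) = star (univRep g) * (univRep g * univRep g⁻¹) := by
        rw [univRep_mul_inv, mul_one]
    _ = univRep g⁻¹ := by rw [← mul_assoc, star_univRep_mul_self, one_mul]

end UnivRep

noncomputable section Eigen

/-- The character of `𝔽₁` with `u ↦ z`, acting by scalars on the whole representation space. -/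
def charRep (z : Circle) : UnitaryRep F1 :=
  FreeGroup.lift fun _ => ⟨(z : ℂ) • 1, by
    rw [Unitary.mem_iff]
    simp [smul_smul, Complex.mul_conj, mul_comm]⟩

/-- A fixed unit vector of the representation space. -/
def vacuum : RepSpace F1 :=
  (lp.single 2 ((1 : F1), (0 : ℕ)) (1 : ℂ) : lp (fun _ : F1 × ℕ => ℂ) 2)

theorem norm_vacuum : ‖vacuum‖ = 1 :=
  (lp.norm_single (E := fun _ : F1 × ℕ => ℂ) (p := 2) (by norm_num) ((1 : F1), (0 : ℕ))
    (1 : ℂ)).trans norm_one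

open scoped Classical in
/-- A unit eigenvector of `u` with eigenvalue `z`: the fixed unit vector in the summand of the
universal representation that belongs to the character `z`. -/
def eigVec (z : Circle) : UnivSpace F1 :=
  (lp.single 2 (charRep z) vacuum : lp (fun _ : UnitaryRep F1 => RepSpace F1) 2)

theorem norm_eigVec (z : Circle) : ‖eigVec z‖ = 1 := by
  classical
  exact (lp.norm_single (E := fun _ : UnitaryRep F1 => RepSpace F1) (p := 2) (by norm_num)
    (charRep z) vacuum).trans norm_vacuum

theorem inner_eigVec (z : Circle) : inner ℂ (eigVec z) (eigVec z) = 1 := by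
  rw [inner_self_eq_norm_sq_to_K, norm_eigVec]; simp

theorem univRep_eigVec (z : Circle) : univRep (FreeGroup.of 0) (eigVec z) = (z : ℂ) • eigVec z := by
  classical
  refine lp.ext (funext fun π => ?_)
  change ((π (FreeGroup.of 0) : unitary _) : RepSpace F1 →L[ℂ] RepSpace F1)
    ((lp.single 2 (charRep z) vacuum : lp (fun _ : UnitaryRep F1 => RepSpace F1) 2) π) =
    (z : ℂ) • ((lp.single 2 (charRep z) vacuum : lp (fun _ : UnitaryRep F1 => RepSpace F1) 2) π)
  by_cases h : π = charRep z
  · subst h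
    simp [charRep]
  · rw [lp.single_apply_ne _ _ _ h, map_zero, smul_zero]

theorem star_univRep_eigVec (z : Circle) :
    star (univRep (FreeGroup.of 0)) (eigVec z) = conj (z : ℂ) • eigVec z := by
  have h : star (univRep (FreeGroup.of (0 : Fin 1))) (univRep (FreeGroup.of 0) (eigVec z)) =
      eigVec z := by
    rw [← mul_apply_eq_comp, star_univRep_mul_self, one_apply_eq_self]
  rw [univRep_eigVec, map_smul] at h
  conv_rhs => rw [← h]
  rw [smul_smul, mul_comm, Complex.mul_conj]
  simp

/-- Evaluation of elements of `S₁` at `z ∈ 𝕋`, as the vector state of the eigenvector at `z`. -/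
def ev (z : Circle) : S1 →ₗ[ℂ] ℂ where
  toFun s := inner ℂ (eigVec z) ((s : UnivSpace F1 →L[ℂ] UnivSpace F1) (eigVec z))
  map_add' s t := by simp
  map_smul' c s := by simp

@[simp] theorem ev_unit (z : Circle) : ev z S1.unit = 1 := inner_eigVec z

@[simp] theorem ev_genU (z : Circle) : ev z genU = z := by
  change inner ℂ (eigVec z) (univRep (FreeGroup.of 0) (eigVec z)) = z
  rw [univRep_eigVec, inner_smul_right, inner_eigVec, mul_one]

@[simp] theorem ev_genUStar (z : Circle) : ev z genUStar = conj (z : ℂ) := by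
  change inner ℂ (eigVec z) (star (univRep (FreeGroup.of 0)) (eigVec z)) = _
  rw [star_univRep_eigVec, inner_smul_right, inner_eigVec, mul_one]

theorem toSubmodule_S1 : S1.toSubmodule = Submodule.span ℂ
    {1, univRep (FreeGroup.of 0), star (univRep (FreeGroup.of 0))} := by
  simp only [S1, groupOpSys, Set.image_singleton]
  congr 1
  ext x
  simp only [Set.union_singleton, Set.mem_insert_iff, Set.mem_singleton_iff]
  tauto

theorem exists_repr (s : S1) : ∃ a b c : ℂ, s = a • S1.unit + b • genU + c • genUStar := by
  have h1 : (s : UnivSpace F1 →L[ℂ] UnivSpace F1) ∈ Submodule.span ℂ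
      {1, univRep (FreeGroup.of 0), star (univRep (FreeGroup.of 0))} := toSubmodule_S1 ▸ s.2
  obtain ⟨a, b, c, h⟩ := Submodule.mem_span_triple.1 h1
  refine ⟨a, b, c, Subtype.ext ?_⟩
  rw [Submodule.coe_add, Submodule.coe_add, Submodule.coe_smul, Submodule.coe_smul,
    Submodule.coe_smul]
  exact h.symm

theorem linearMap_ext {V : Type*} [AddCommGroup V] [Module ℂ V] {φ ψ : S1 →ₗ[ℂ] V}
    (h0 : φ S1.unit = ψ S1.unit) (h1 : φ genU = ψ genU) (h2 : φ genUStar = ψ genUStar) :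
    φ = ψ := by
  ext s
  obtain ⟨a, b, c, rfl⟩ := exists_repr s
  simp [h0, h1, h2]

theorem apply_eigVec (s : S1) (z : Circle) :
    (s : UnivSpace F1 →L[ℂ] UnivSpace F1) (eigVec z) = ev z s • eigVec z := by
  have h0 : (S1.unit : UnivSpace F1 →L[ℂ] UnivSpace F1) (eigVec z) = eigVec z := rfl
  have h1 : (genU : UnivSpace F1 →L[ℂ] UnivSpace F1) (eigVec z) = (z : ℂ) • eigVec z :=
    univRep_eigVec z
  have h2 : (genUStar : UnivSpace F1 →L[ℂ] UnivSpace F1) (eigVec z) = conj (z : ℂ) • eigVec z :=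
    star_univRep_eigVec z
  obtain ⟨a, b, c, rfl⟩ := exists_repr s
  simp only [Submodule.coe_add, Submodule.coe_smul, _root_.add_apply, _root_.smul_apply, h0, h1, h2,
    map_add, map_smul, ev_unit, ev_genU, ev_genUStar]
  module

/-- The coefficient of `1` of an element of `S₁`. -/
def coeffUnit : S1 →ₗ[ℂ] ℂ := (2⁻¹ : ℂ) • (ev 1 + ev (-1))

@[simp] theorem coeffUnit_unit : coeffUnit S1.unit = 1 := by
  simp [coeffUnit]; norm_num

@[simp] theorem coeffUnit_genU : coeffUnit genU = 0 := by simp [coeffUnit]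

@[simp] theorem coeffUnit_genUStar : coeffUnit genUStar = 0 := by simp [coeffUnit]

end Eigen

/-! ### Positivity of products of commuting maps -/

section PosMatrix
variable {L : Type*} [NormedAddCommGroup L] [InnerProductSpace ℂ L] {n : ℕ}

theorem IsPosMatrix.add {X Y : Matrix (Fin n) (Fin n) (L →L[ℂ] L)} (hX : IsPosMatrix X)
    (hY : IsPosMatrix Y) : IsPosMatrix (X + Y) := fun ξ => by
  simpa [inner_add_right, Finset.sum_add_distrib] using add_nonneg (hX ξ) (hY ξ)

theorem isPosMatrix_sum {ι : Type*} (s : Finset ι) {X : ι → Matrix (Fin n) (Fin n) (L →L[ℂ] L)}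
    (hX : ∀ i ∈ s, IsPosMatrix (X i)) : IsPosMatrix (∑ i ∈ s, X i) := by
  classical
  induction s using Finset.induction_on with
  | empty => intro ξ; simp
  | insert i s hi ih =>
    rw [Finset.sum_insert hi]
    exact (hX i (Finset.mem_insert_self i s)).add
      (ih fun j hj => hX j (Finset.mem_insert_of_mem hj))

theorem isPosMatrix_of_tendsto {ι : Type*} {l : Filter ι} [l.NeBot]
    {X : ι → Matrix (Fin n) (Fin n) (L →L[ℂ] L)} {Y : Matrix (Fin n) (Fin n) (L →L[ℂ] L)}
    (hXY : ∀ i j, Tendsto (fun a => X a i j) l (𝓝 (Y i j))) (hX : ∀ a, IsPosMatrix (X a)) :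
    IsPosMatrix Y := by
  intro ξ
  have h : Tendsto (fun a => ∑ i, ∑ j, inner ℂ (ξ i) (X a i j (ξ j))) l
      (𝓝 (∑ i, ∑ j, inner ℂ (ξ i) (Y i j (ξ j)))) := by
    refine tendsto_finsetSum _ fun i _ => tendsto_finsetSum _ fun j _ => ?_
    exact tendsto_const_nhds.inner
      (((ContinuousLinearMap.apply ℂ L (ξ j)).continuous.tendsto _).comp (hXY i j))
  exact ge_of_tendsto' h fun a => hX a ξ

open scoped MatrixOrder Matrix.Norms.L2Operator in
/-- The tensor product of a positive semidefinite scalar matrix and a positive operator. -/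
theorem isPosMatrix_smul {M : Matrix (Fin n) (Fin n) ℂ} (hM : M.PosSemidef) {R : L →L[ℂ] L}
    (hR : R.IsPositive) : IsPosMatrix (Matrix.of fun i j => M i j • R) := by
  obtain ⟨B, rfl⟩ := CStarAlgebra.nonneg_iff_eq_star_mul_self.1 hM.nonneg
  intro ξ
  have h : ∀ k, (0 : ℂ) ≤ ∑ i, ∑ j, (conj (B k i) * B k j) * inner ℂ (ξ i) (R (ξ j)) := by
    intro k
    have := hR.inner_nonneg_right (∑ i, B k i • ξ i)
    simp only [map_sum, map_smul, sum_inner, inner_sum, inner_smul_left, inner_smul_right,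
      Finset.mul_sum] at this
    rw [Finset.sum_comm] at this
    refine this.trans_eq (Finset.sum_congr rfl fun i _ => Finset.sum_congr rfl fun j _ => ?_)
    ring
  have h2 := Finset.sum_nonneg (s := Finset.univ) fun k _ => h k
  rw [Finset.sum_comm] at h2
  refine h2.trans_eq (Finset.sum_congr rfl fun i _ => ?_)
  rw [Finset.sum_comm]
  refine Finset.sum_congr rfl fun j _ => ?_
  simp [Matrix.mul_apply, Finset.sum_mul]

end PosMatrix

noncomputable section Torus

/-- Evaluation of elements of `S₁ ⊗ S₁` at `(z, w) ∈ 𝕋²`. -/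
def ev₂ (z w : Circle) : S1 ⊗[ℂ] S1 →ₗ[ℂ] ℂ :=
  TensorProduct.lift ((LinearMap.mul ℂ ℂ).compl₁₂ (ev z) (ev w))

@[simp] theorem ev₂_tmul (z w : Circle) (s t : S1) : ev₂ z w (s ⊗ₜ t) = ev z s * ev w t := rfl

/-- The matrices over `S₁ ⊗ S₁` that are positive semidefinite at every point of the torus. -/
def torusCone (n : ℕ) : Set (Matrix (Fin n) (Fin n) (S1 ⊗[ℂ] S1)) :=
  {X | ∀ z w, (X.map (ev₂ z w)).PosSemidef}

variable {L : Type*} [NormedAddCommGroup L] [InnerProductSpace ℂ L]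

/-- The positivity of `φ` at the single element `[1, u; u*, 1]` of `M₂(S₁)₊`.  For maps on `S₁` this
already forces complete positivity. -/
def IsBlockPositive (φ : S1 →ₗ[ℂ] (L →L[ℂ] L)) : Prop :=
  IsPosMatrix !![φ S1.unit, φ genU; φ genUStar, φ S1.unit]

theorem mulMap_tmul {φ ψ : S1 →ₗ[ℂ] (L →L[ℂ] L)} (s t : S1) :
    mulMap φ ψ (s ⊗ₜ t) = φ s * ψ t := rfl

theorem tendsto_mulMap {ι : Type*} {l : Filter ι} {φ ψ : ι → S1 →ₗ[ℂ] (L →L[ℂ] L)}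
    {φ₀ ψ₀ : S1 →ₗ[ℂ] (L →L[ℂ] L)} (hφ : ∀ s, Tendsto (fun a => φ a s) l (𝓝 (φ₀ s)))
    (hψ : ∀ s, Tendsto (fun a => ψ a s) l (𝓝 (ψ₀ s))) (x : S1 ⊗[ℂ] S1) :
    Tendsto (fun a => mulMap (φ a) (ψ a) x) l (𝓝 (mulMap φ₀ ψ₀ x)) := by
  induction x with
  | zero => simpa using tendsto_const_nhds
  | tmul s t => simpa only [mulMap_tmul] using (hφ s).mul (hψ t)
  | add x y hx hy => simpa only [map_add] using hx.add hy

/-- The completely positive map `s ↦ ∑ s(z_j) P_j` of a finitely supported operator measure on the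
circle. -/
def atomicMap {ι : Type*} [Fintype ι] (z : ι → Circle) (P : ι → (L →L[ℂ] L)) :
    S1 →ₗ[ℂ] (L →L[ℂ] L) :=
  ∑ j, (ev (z j)).smulRight (P j)

theorem atomicMap_apply {ι : Type*} [Fintype ι] (z : ι → Circle) (P : ι → (L →L[ℂ] L)) (s : S1) :
    atomicMap z P s = ∑ j, ev (z j) s • P j := by
  simp [atomicMap]

theorem mulMap_atomicMap {ι κ : Type*} [Fintype ι] [Fintype κ] (z : ι → Circle) (w : κ → Circle)
    (P : ι → (L →L[ℂ] L)) (Q : κ → (L →L[ℂ] L)) (x : S1 ⊗[ℂ] S1) :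
    mulMap (atomicMap z P) (atomicMap w Q) x = ∑ j, ∑ l, ev₂ (z j) (w l) x • (P j * Q l) := by
  induction x with
  | zero => simp
  | tmul s t =>
    simp only [mulMap_tmul, atomicMap_apply, Finset.sum_mul_sum, smul_mul_smul_comm, ev₂_tmul]
  | add x y hx hy => simp only [map_add, hx, hy, add_smul, Finset.sum_add_distrib]

variable [CompleteSpace L]

theorem isPosMatrix_mulMap_atomicMap {ι κ : Type*} [Fintype ι] [Fintype κ] (z : ι → Circle)
    (w : κ → Circle) {P : ι → (L →L[ℂ] L)} {Q : κ → (L →L[ℂ] L)} (hP : ∀ j, 0 ≤ P j)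
    (hQ : ∀ l, 0 ≤ Q l) (hPQ : ∀ j l, Commute (P j) (Q l)) {n : ℕ}
    {X : Matrix (Fin n) (Fin n) (S1 ⊗[ℂ] S1)} (hX : X ∈ torusCone n) :
    IsPosMatrix (X.map (mulMap (atomicMap z P) (atomicMap w Q))) := by
  have h : X.map (mulMap (atomicMap z P) (atomicMap w Q)) =
      ∑ j, ∑ l, Matrix.of fun a b => (X.map (ev₂ (z j) (w l))) a b • (P j * Q l) := by
    ext1 a b
    simp [mulMap_atomicMap, Matrix.sum_apply]
  rw [h]
  refine isPosMatrix_sum _ fun j _ => isPosMatrix_sum _ fun l _ => isPosMatrix_smul (hX _ _) ?_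
  exact (ContinuousLinearMap.nonneg_iff_isPositive _).1 ((hPQ j l).mul_nonneg (hP j) (hQ l))

/-- A block positive map, perturbed by a multiple of the coefficient of `1`, is a limit of atomic
maps whose weights commute with all that commutes with the range. -/
theorem exists_atomicMap_tendsto {φ : S1 →ₗ[ℂ] (L →L[ℂ] L)} (hφ : IsBlockPositive φ) {ε : ℝ}
    (hε : 0 < ε) :
    ∃ P : ∀ N : ℕ, ZMod (N + 2) → (L →L[ℂ] L), (∀ N j, 0 ≤ P N j) ∧
      (∀ C, (∀ s, Commute C (φ s)) → ∀ N j, Commute C (P N j)) ∧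
      ∀ s, Tendsto (fun N => atomicMap (fun j => ZMod.toCircle j) (P N) s) atTop
        (𝓝 (φ s + (ε * coeffUnit s : ℂ) • 1)) := by
  obtain ⟨P, hP, hPc, h0, h1, h2⟩ := exists_quadrature_of_isPosMatrix hφ hε
  refine ⟨P, hP, fun C hC => hPc C (hC _) (hC _) (hC _), fun s => ?_⟩
  obtain ⟨a, b, c, rfl⟩ := exists_repr s
  have := ((h0.const_smul a).add (h1.const_smul b)).add (h2.const_smul c)
  have hlim : φ (a • S1.unit + b • genU + c • genUStar) +
      (ε * coeffUnit (a • S1.unit + b • genU + c • genUStar) : ℂ) • 1 =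
      a • (φ S1.unit + (ε : ℂ) • 1) + b • φ genU + c • φ genUStar := by
    simp only [map_add, map_smul, coeffUnit_unit, coeffUnit_genU, coeffUnit_genUStar, smul_eq_mul]
    module
  rw [hlim]
  refine this.congr fun N => ?_
  simp only [atomicMap_apply, Finset.smul_sum, ← Finset.sum_add_distrib, map_add, map_smul,
    ev_unit, ev_genU, ev_genUStar]
  refine Finset.sum_congr rfl fun j _ => ?_
  module

/-- Positivity on the torus is preserved by products of commuting block positive maps: for atomic
maps the image is a sum of products of scalar positive matrices with products of commuting positive
operators, and atomic maps are dense. -/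
theorem isPosMatrix_mulMap {φ ψ : S1 →ₗ[ℂ] (L →L[ℂ] L)} (hφ : IsBlockPositive φ)
    (hψ : IsBlockPositive ψ) (hc : ∀ s t, Commute (φ s) (ψ t)) {n : ℕ}
    {X : Matrix (Fin n) (Fin n) (S1 ⊗[ℂ] S1)} (hX : X ∈ torusCone n) :
    IsPosMatrix (X.map (mulMap φ ψ)) := by
  -- `φ` and `ψ` are shifted by `ε = 1 / (m + 1)` to make the images of `1` invertible
  let φ' (χ : S1 →ₗ[ℂ] (L →L[ℂ] L)) (m : ℕ) : S1 →ₗ[ℂ] (L →L[ℂ] L) :=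
    χ + ((1 / ((m : ℝ) + 1) : ℝ) : ℂ) • coeffUnit.smulRight 1
  have hφ' : ∀ χ s, Tendsto (fun m => φ' χ m s) atTop (𝓝 (χ s)) := by
    intro χ s
    have h1 := (Complex.continuous_ofReal.tendsto 0).comp
      (tendsto_one_div_add_atTop_nhds_zero_nat (𝕜 := ℝ))
    have h2 := (h1.smul_const ((coeffUnit s) • (1 : L →L[ℂ] L))).const_add (χ s)
    simpa [φ'] using h2
  refine isPosMatrix_of_tendsto (X := fun m => X.map (mulMap (φ' φ m) (φ' ψ m)))
    (fun i j => tendsto_mulMap (hφ' φ) (hφ' ψ) (X i j)) fun m => ?_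
  have hm : (0 : ℝ) < 1 / ((m : ℝ) + 1) := by positivity
  obtain ⟨P, hP, hPc, hPt⟩ := exists_atomicMap_tendsto hφ hm
  obtain ⟨Q, hQ, hQc, hQt⟩ := exists_atomicMap_tendsto hψ hm
  refine isPosMatrix_of_tendsto (X := fun N => X.map
    (mulMap (atomicMap (fun j => ZMod.toCircle j) (P N))
      (atomicMap (fun j => ZMod.toCircle j) (Q N))))
    (l := atTop) (fun i j => tendsto_mulMap ?_ ?_ (X i j)) fun N =>
      isPosMatrix_mulMap_atomicMap _ _ (hP N) (hQ N) (fun j l => ?_) hX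
  · intro s
    simpa [φ', smul_smul] using hPt s
  · intro s
    simpa [φ', smul_smul] using hQt s
  -- the weights of `φ` commute with the range of `ψ`, hence with the weights of `ψ`
  · exact hQc _ (fun t => (hPc _ (fun s => (hc s t).symm) N j).symm) N l

end Torus

/-! ### The cones min and c as positivity on the torus -/

/-- Over `ℂ` a matrix with nonnegative quadratic form is automatically Hermitian. -/
theorem posSemidef_of_forall_nonneg {n : ℕ} {M : Matrix (Fin n) (Fin n) ℂ}
    (h : ∀ v : Fin n → ℂ, 0 ≤ ∑ i, ∑ j, conj (v i) * M i j * v j) : M.PosSemidef := by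
  rw [← Matrix.isPositive_toEuclideanLin_iff, LinearMap.isPositive_iff_complex]
  intro x
  set S : ℂ := ∑ i, ∑ j, conj (x.ofLp i) * M i j * x.ofLp j with hS
  have h1 : inner ℂ (M.toEuclideanLin x) x = conj S := by
    rw [← inner_conj_symm, hS]
    congr 1
    simp only [PiLp.inner_apply, Matrix.toLpLin_apply, Matrix.mulVec, dotProduct,
      RCLike.inner_apply, Finset.sum_mul]
    refine Finset.sum_congr rfl fun i _ => Finset.sum_congr rfl fun j _ => ?_
    ring
  obtain ⟨h2, h3⟩ : 0 ≤ S.re ∧ 0 = S.im := Complex.nonneg_iff.1 (h x.ofLp)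
  clear_value S
  rw [h1]
  exact ⟨Complex.ext (by simp) (by simp [← h3]), by simpa using h2⟩

/-- Testing a positive operator matrix on multiples of a common eigenvector of its entries. -/
theorem posSemidef_of_isPosMatrix {H : Type*} [NormedAddCommGroup H] [InnerProductSpace ℂ H]
    {n : ℕ} {X : Matrix (Fin n) (Fin n) (H →L[ℂ] H)} (hX : IsPosMatrix X) {e : H}
    (he : inner ℂ e e = (1 : ℂ)) {M : Matrix (Fin n) (Fin n) ℂ} (hM : ∀ i j, X i j e = M i j • e) :
    M.PosSemidef := by
  refine posSemidef_of_forall_nonneg fun v => (hX fun i => v i • e).trans_eq ?_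
  refine Finset.sum_congr rfl fun i _ => Finset.sum_congr rfl fun j _ => ?_
  rw [map_smul, hM, inner_smul_left, inner_smul_right, inner_smul_right, he]
  ring

noncomputable section

section Tensor

variable {H K : Type*} [NormedAddCommGroup H] [InnerProductSpace ℂ H]
  [NormedAddCommGroup K] [InnerProductSpace ℂ K]

theorem tensorOp_mul (x x' : H →L[ℂ] H) (y y' : K →L[ℂ] K) :
    tensorOp x y * tensorOp x' y' = tensorOp (x * x') (y * y') := by
  refine ext_hilbertTensor fun ξ => ?_
  rw [mul_apply_eq_comp, tensorOp_coe, tensorOp_coe, tensorOp_coe]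
  congr 1
  induction ξ with
  | zero => simp
  | tmul a b => rfl
  | add a b ha hb => simp only [map_add, ha, hb]

theorem tensorOp_one_one : tensorOp (1 : H →L[ℂ] H) (1 : K →L[ℂ] K) = 1 := by
  refine ext_hilbertTensor fun ξ => ?_
  rw [tensorOp_coe, one_apply_eq_self]
  congr 1
  induction ξ with
  | zero => simp
  | tmul a b => rfl
  | add a b ha hb => simp only [map_add, ha, hb]

theorem star_tensorOp [CompleteSpace H] [CompleteSpace K] (x : H →L[ℂ] H) (y : K →L[ℂ] K) :
    star (tensorOp x y) = tensorOp (star x) (star y) := by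
  refine ((ContinuousLinearMap.eq_adjoint_iff _ _).2 fun ξ η => ?_).symm
  induction ξ, η using UniformSpace.Completion.induction_on₂ with
  | hp => exact isClosed_eq (by fun_prop) (by fun_prop)
  | ih ξ η =>
    rw [tensorOp_coe, tensorOp_coe, UniformSpace.Completion.inner_coe,
      UniformSpace.Completion.inner_coe]
    induction ξ with
    | zero => simp
    | add a b ha hb => simp only [map_add, inner_add_left, ha, hb]
    | tmul a b =>
      induction η with
      | zero => simp
      | add c d hc hd => simp only [map_add, inner_add_right, hc, hd]
      | tmul c d =>
        change inner ℂ (star x a ⊗ₜ[ℂ] star y b) (c ⊗ₜ[ℂ] d) =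
          inner ℂ (a ⊗ₜ[ℂ] b) (x c ⊗ₜ[ℂ] y d)
        simp [TensorProduct.inner_tmul, ContinuousLinearMap.star_eq_adjoint,
          ContinuousLinearMap.adjoint_inner_left]

end Tensor

theorem isPosMatrix_of_isometry {L : Type*} [NormedAddCommGroup L] [InnerProductSpace ℂ L]
    [CompleteSpace L] {V : L →L[ℂ] L} (hV : star V * V = 1) :
    IsPosMatrix !![1, V; star V, 1] := by
  rw [isPosMatrix_two]
  intro x y
  have hy : inner ℂ y y = inner ℂ (V y) (V y) := by
    rw [← ContinuousLinearMap.adjoint_inner_right, ← ContinuousLinearMap.star_eq_adjoint,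
      ← mul_apply_eq_comp, hV, one_apply_eq_self]
  rw [one_apply_eq_self, one_apply_eq_self, hy, ContinuousLinearMap.star_eq_adjoint,
    ContinuousLinearMap.adjoint_inner_right, ← inner_add_right, ← inner_add_right, ← inner_add_left,
    inner_self_eq_norm_sq_to_K]
  positivity

theorem isBlockPositive_of_isometry {L : Type*} [NormedAddCommGroup L] [InnerProductSpace ℂ L]
    [CompleteSpace L] {φ : S1 →ₗ[ℂ] (L →L[ℂ] L)} (h1 : φ S1.unit = 1)
    (hs : φ genUStar = star (φ genU)) (hu : star (φ genU) * φ genU = 1) : IsBlockPositive φ := by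
  rw [IsBlockPositive, h1, hs]
  exact isPosMatrix_of_isometry hu

theorem map_two {α β : Type*} (f : α → β) (a b c d : α) :
    (!![a, b; c, d]).map f = !![f a, f b; f c, f d] := by
  ext i j; fin_cases i <;> fin_cases j <;> rfl

theorem isBlockPositive_of_isCompletelyPositive {L : Type*} [NormedAddCommGroup L]
    [InnerProductSpace ℂ L] {φ : S1 →ₗ[ℂ] (L →L[ℂ] L)} (hφ : IsCompletelyPositive S1 φ) :
    IsBlockPositive φ := by
  have h : IsBlockPositive S1.toSubmodule.subtype :=
    isBlockPositive_of_isometry rfl rfl (star_univRep_mul_self _)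
  have h2 := hφ 2 !![S1.unit, genU; genUStar, S1.unit] (by
    rw [OperatorSystem.cone, Set.mem_ofPred_eq, map_two]; exact h)
  rwa [map_two] at h2

theorem posSemidef_map_ev {k : ℕ} {P : Matrix (Fin k) (Fin k) S1} (hP : P ∈ S1.cone k)
    (z : Circle) : (P.map (ev z)).PosSemidef :=
  posSemidef_of_isPosMatrix hP (inner_eigVec z) fun i j => apply_eigVec (P i j) z

theorem spatialMap_tmul (s t : S1) : spatialMap S1 S1 (s ⊗ₜ t) = tensorOp s t := rfl

theorem spatialMap_apply_eigVec (x : S1 ⊗[ℂ] S1) (z w : Circle) :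
    spatialMap S1 S1 x ((eigVec z ⊗ₜ[ℂ] eigVec w : UnivSpace F1 ⊗[ℂ] UnivSpace F1) :
      HilbertTensor (UnivSpace F1) (UnivSpace F1)) =
      ev₂ z w x • ((eigVec z ⊗ₜ[ℂ] eigVec w : UnivSpace F1 ⊗[ℂ] UnivSpace F1) :
      HilbertTensor (UnivSpace F1) (UnivSpace F1)) := by
  induction x with
  | zero => simp
  | add x y hx hy => simp only [map_add, _root_.add_apply, hx, hy, add_smul]
  | tmul s t =>
    rw [spatialMap_tmul, tensorOp_coe, ev₂_tmul, ← UniformSpace.Completion.coe_smul]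
    congr 1
    change (s : UnivSpace F1 →L[ℂ] UnivSpace F1) (eigVec z) ⊗ₜ[ℂ]
      (t : UnivSpace F1 →L[ℂ] UnivSpace F1) (eigVec w) = _
    rw [apply_eigVec, apply_eigVec, TensorProduct.smul_tmul_smul]

theorem minCone_eq_torusCone (n : ℕ) : minCone S1 S1 n = torusCone n := by
  ext X
  constructor
  · intro hX z w
    refine posSemidef_of_isPosMatrix hX ?_ fun i j => spatialMap_apply_eigVec (X i j) z w
    rw [UniformSpace.Completion.inner_coe, TensorProduct.inner_tmul, inner_eigVec, inner_eigVec,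
      one_mul]
  · intro hX
    let φ : S1 →ₗ[ℂ] (HilbertTensor (UnivSpace F1) (UnivSpace F1) →L[ℂ]
        HilbertTensor (UnivSpace F1) (UnivSpace F1)) :=
      (tensorOpBilin.flip 1) ∘ₗ S1.toSubmodule.subtype
    let ψ : S1 →ₗ[ℂ] (HilbertTensor (UnivSpace F1) (UnivSpace F1) →L[ℂ]
        HilbertTensor (UnivSpace F1) (UnivSpace F1)) :=
      (tensorOpBilin 1) ∘ₗ S1.toSubmodule.subtype
    have hφ : ∀ s, φ s = tensorOp s 1 := fun s => rfl
    have hψ : ∀ s, ψ s = tensorOp 1 s := fun s => rfl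
    have h : mulMap φ ψ = spatialMap S1 S1 := by
      refine TensorProduct.ext' fun s t => ?_
      rw [mulMap_tmul, spatialMap_tmul, hφ, hψ, tensorOp_mul, one_mul, mul_one]
    have hu : star (genU : UnivSpace F1 →L[ℂ] UnivSpace F1) * genU = 1 := star_univRep_mul_self _
    have key := isPosMatrix_mulMap (φ := φ) (ψ := ψ)
      (isBlockPositive_of_isometry (by rw [hφ]; exact tensorOp_one_one)
        (by rw [hφ, hφ, star_tensorOp, star_one]; rfl)
        (by rw [hφ, star_tensorOp, tensorOp_mul, hu, star_one, one_mul, tensorOp_one_one]))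
      (isBlockPositive_of_isometry (by rw [hψ]; exact tensorOp_one_one)
        (by rw [hψ, hψ, star_tensorOp, star_one]; rfl)
        (by rw [hψ, star_tensorOp, tensorOp_mul, hu, star_one, one_mul, tensorOp_one_one]))
      (fun s t => by
        rw [Commute, SemiconjBy, hφ, hψ, tensorOp_mul, tensorOp_mul]
        simp only [one_mul, mul_one]) hX
    rwa [h] at key

theorem isCompletelyPositive_ev {L : Type*} [NormedAddCommGroup L] [InnerProductSpace ℂ L]
    [CompleteSpace L] (z : Circle) :
    IsCompletelyPositive S1 ((ev z).smulRight (1 : L →L[ℂ] L)) := fun _ _ hP =>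
  isPosMatrix_smul (posSemidef_map_ev hP z) ContinuousLinearMap.isPositive_one

theorem commCone_eq_torusCone (n : ℕ) : commCone.{0, 0, w} S1 S1 n = torusCone n := by
  ext X
  constructor
  · intro hX z w
    -- a one-dimensional Hilbert space in the universe of the definition of `commCone`
    let L := EuclideanSpace ℂ PUnit.{w + 1}
    have h := hX L ((ev z).smulRight 1) ((ev w).smulRight 1) (isCompletelyPositive_ev z)
      (isCompletelyPositive_ev w) fun s t =>
        ((Commute.one_left _).smul_left _)
    refine posSemidef_of_isPosMatrix h (e := EuclideanSpace.single PUnit.unit (1 : ℂ)) ?_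
      fun i j => ?_
    · have he : ‖(EuclideanSpace.single PUnit.unit (1 : ℂ) :
          EuclideanSpace ℂ PUnit.{w + 1})‖ = 1 := by simp
      rw [inner_self_eq_norm_sq_to_K, he]
      simp
    · have : ∀ x, mulMap ((ev z).smulRight (1 : L →L[ℂ] L)) ((ev w).smulRight 1) x =
          ev₂ z w x • 1 := by
        intro x
        induction x with
        | zero => simp
        | tmul s t =>
          rw [mulMap_tmul]
          simp only [LinearMap.smulRight_apply, smul_mul_smul_comm, mul_one, ev₂_tmul]
        | add x y hx hy => simp only [map_add, hx, hy, add_smul]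
      simp only [Matrix.map_apply]
      erw [this]
      rfl
  · intro hX L _ _ _ φ ψ hφ hψ hc
    exact isPosMatrix_mulMap (isBlockPositive_of_isCompletelyPositive hφ)
      (isBlockPositive_of_isCompletelyPositive hψ) hc hX

end

/-! ### The first level of the max cone -/

noncomputable section

/-- Block positive maps on `S₁` are completely positive. -/
theorem isPosMatrix_map {L : Type*} [NormedAddCommGroup L] [InnerProductSpace ℂ L]
    [CompleteSpace L] {φ : S1 →ₗ[ℂ] (L →L[ℂ] L)} (hφ : IsBlockPositive φ) {k : ℕ}
    {P : Matrix (Fin k) (Fin k) S1} (hP : ∀ z, (P.map (ev z)).PosSemidef) :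
    IsPosMatrix (P.map φ) := by
  have hX : P.map (fun s => s ⊗ₜ[ℂ] S1.unit) ∈ torusCone k := fun z w => by
    have : (P.map (fun s => s ⊗ₜ[ℂ] S1.unit)).map (ev₂ z w) = P.map (ev z) := by
      ext i j; simp
    rw [this]
    exact hP z
  have h := isPosMatrix_mulMap hφ
    (isBlockPositive_of_isCompletelyPositive (isCompletelyPositive_ev (L := L) 1))
    (fun s t => (Commute.one_right _).smul_right _) hX
  convert h using 1
  ext1 i j
  simp [mulMap_tmul]

theorem mem_cone_iff {k : ℕ} {P : Matrix (Fin k) (Fin k) S1} :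
    P ∈ S1.cone k ↔ ∀ z, (P.map (ev z)).PosSemidef :=
  ⟨posSemidef_map_ev, fun h => isPosMatrix_map (φ := S1.toSubmodule.subtype)
    (isBlockPositive_of_isometry rfl rfl (star_univRep_mul_self _)) h⟩

theorem exists_repr_tensor (x : S1 ⊗[ℂ] S1) :
    ∃ a b c : S1, x = a ⊗ₜ S1.unit + b ⊗ₜ genU + c ⊗ₜ genUStar := by
  induction x with
  | zero => exact ⟨0, 0, 0, by simp⟩
  | tmul s t =>
    obtain ⟨a, b, c, rfl⟩ := exists_repr t
    exact ⟨a • s, b • s, c • s, by simp only [TensorProduct.tmul_add, TensorProduct.tmul_smul,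
      TensorProduct.smul_tmul']⟩
  | add x y hx hy =>
    obtain ⟨a, b, c, rfl⟩ := hx
    obtain ⟨a', b', c', rfl⟩ := hy
    refine ⟨a + a', b + b', c + c', ?_⟩
    simp only [TensorProduct.add_tmul]
    abel

theorem exists_circle_eq (q : ℂ) : ∃ w : Circle, q = ‖q‖ * w :=
  ⟨Circle.exp q.arg, by rw [Circle.coe_exp, Complex.norm_mul_exp_arg_mul_I]⟩

/-- If `a + b w + c w̄ ≥ 0` on the circle then `|b| ≤ a / 2` and `c = b̄`, in the form used for
functions `a`, `b`, `c` on the circle. -/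
theorem posSemidef_of_forall_circle {a b c : ℂ}
    (h : ∀ w : Circle, 0 ≤ a + b * w + c * conj (w : ℂ)) :
    (!![2⁻¹ * a, b; c, 2⁻¹ * a]).PosSemidef := by
  have ha : 0 ≤ a := by
    -- averaging over `w = ±1` removes the odd part
    have h1 := add_nonneg (h 1) (h (-1))
    simp only [Circle.coe_one, Circle.coe_neg, map_one, map_neg] at h1
    have h2 := mul_nonneg (show (0 : ℂ) ≤ 2⁻¹ by positivity) h1
    refine h2.trans_eq (by ring)
  refine posSemidef_of_forall_nonneg fun v => ?_
  -- with `w` the phase of `v̄₀ v₁`, the form at `v` is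
  -- `(a / 2) (‖v₀‖ - ‖v₁‖)² + ‖v₀‖ ‖v₁‖ (a + b w + c w̄)`
  obtain ⟨w, hw⟩ := exists_circle_eq (conj (v 0) * v 1)
  have hw' := congrArg conj hw
  simp only [map_mul, Complex.conj_conj, Complex.conj_ofReal] at hw'
  have hn : ((‖conj (v 0) * v 1‖ : ℝ) : ℂ) = (‖v 0‖ : ℂ) * ‖v 1‖ := by simp
  rw [hn] at hw hw'
  have h0 : conj (v 0) * v 0 = (‖v 0‖ : ℂ) ^ 2 := Complex.conj_mul' _
  have h1 : conj (v 1) * v 1 = (‖v 1‖ : ℂ) ^ 2 := Complex.conj_mul' _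
  have key : 0 ≤ 2⁻¹ * a * (((‖v 0‖ - ‖v 1‖) ^ 2 : ℝ) : ℂ) +
      ((‖v 0‖ * ‖v 1‖ : ℝ) : ℂ) * (a + b * w + c * conj (w : ℂ)) := by
    refine add_nonneg (mul_nonneg (mul_nonneg (by positivity) ha) ?_) (mul_nonneg ?_ (h w))
    · exact Complex.zero_le_real.2 (sq_nonneg _)
    · exact_mod_cast (by positivity : (0 : ℝ) ≤ ‖v 0‖ * ‖v 1‖)
  refine key.trans_eq ?_
  simp only [Fin.sum_univ_two, Matrix.of_apply, Matrix.cons_val', Matrix.cons_val_zero,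
    Matrix.cons_val_one, Matrix.cons_val_fin_one]
  push_cast
  linear_combination (-(2⁻¹ * a)) * h0 - 2⁻¹ * a * h1 - b * hw - c * hw'

/-- A positive scalar `a + b w + c w̄`, with coefficients in `S₁`, is the sum `∑ M_ij ⊗ Q_ij` for
the positive matrices `M = [a/2, b; c, a/2]` and `Q = [1, u; u*, 1]`. -/
theorem torusCone_one_subset_preMaxCone : torusCone 1 ⊆ preMaxCone S1 S1 1 := by
  intro X hX
  obtain ⟨a, b, c, h⟩ := exists_repr_tensor (X 0 0)
  refine ⟨2, 2, Matrix.of fun p _ => if p.1 = p.2 then 1 else 0,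
    !![(2⁻¹ : ℂ) • a, b; c, (2⁻¹ : ℂ) • a], ?_, !![S1.unit, genU; genUStar, S1.unit], ?_, ?_⟩
  · refine mem_cone_iff.2 fun z => ?_
    rw [map_two, map_smul, smul_eq_mul]
    refine posSemidef_of_forall_circle fun w => ?_
    have := (hX z w).diag_nonneg (i := 0)
    simpa [h] using this
  · rw [OperatorSystem.cone, Set.mem_ofPred_eq, map_two]
    exact isPosMatrix_of_isometry (star_univRep_mul_self _)
  · ext i j
    rw [Fin.fin_one_eq_zero i, Fin.fin_one_eq_zero j, h]
    simp [compress, Fintype.sum_prod_type, Fin.sum_univ_two, ← TensorProduct.smul_tmul']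
    generalize a ⊗ₜ[ℂ] S1.unit = x, b ⊗ₜ[ℂ] genU = y, c ⊗ₜ[ℂ] genUStar = t
    have hx : x = (2⁻¹ : ℂ) • x + (2⁻¹ : ℂ) • x := by rw [← add_smul]; norm_num
    conv_lhs => rw [hx]
    ac_rfl

theorem map_matrixUnit (z w : Circle) (n : ℕ) : (matrixUnit S1 S1 n).map (ev₂ z w) = 1 := by
  rw [matrixUnit, Matrix.diagonal_map (map_zero _)]
  simp

theorem torusCone_one_subset_maxCone : torusCone 1 ⊆ maxCone S1 S1 1 := by
  intro X hX ε hε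
  refine torusCone_one_subset_preMaxCone fun z w => ?_
  have : ((ε : ℂ) • matrixUnit S1 S1 1 + X).map (ev₂ z w) = (ε : ℂ) • 1 + X.map (ev₂ z w) := by
    rw [← map_matrixUnit z w]
    ext i j; simp
  rw [this]
  exact (Matrix.PosSemidef.one.smul (by exact_mod_cast hε.le)).add (hX z w)

/-- The odd part `b z + c z̄` at `z` of `a + b u + c u*`. -/
def coeffOdd (z : Circle) : S1 →ₗ[ℂ] ℂ := (2⁻¹ : ℂ) • (ev z - ev (-z))

/-- The imaginary unit as a point of the circle. -/
def circleI : Circle := ⟨Complex.I, by simp [Submonoid.unitSphere]⟩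

/-- The coefficient of `u` of an element of `S₁`. -/
def coeffU : S1 →ₗ[ℂ] ℂ := (2⁻¹ : ℂ) • (coeffOdd 1 - Complex.I • coeffOdd circleI)
/-- The coefficient of `u*` of an element of `S₁`. -/
def coeffUStar : S1 →ₗ[ℂ] ℂ := (2⁻¹ : ℂ) • (coeffOdd 1 + Complex.I • coeffOdd circleI)

@[simp] theorem coe_circleI : (circleI : ℂ) = Complex.I := rfl

@[simp] theorem coeffU_unit : coeffU S1.unit = 0 := by simp [coeffU, coeffOdd]
@[simp] theorem coeffU_genU : coeffU genU = 1 := by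
  simp [coeffU, coeffOdd]; ring_nf; simp; norm_num
@[simp] theorem coeffU_genUStar : coeffU genUStar = 0 := by
  simp [coeffU, coeffOdd]; ring_nf; simp
@[simp] theorem coeffUStar_unit : coeffUStar S1.unit = 0 := by simp [coeffUStar, coeffOdd]
@[simp] theorem coeffUStar_genU : coeffUStar genU = 0 := by
  simp [coeffUStar, coeffOdd]; ring_nf; simp
@[simp] theorem coeffUStar_genUStar : coeffUStar genUStar = 1 := by
  simp [coeffUStar, coeffOdd]; ring_nf; simp; norm_num

end

/-! ### A functional separating `h` from the max cone -/

noncomputable section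

/-- The sesquilinear form `⟨x, M y⟩` of a scalar matrix. -/
def sesq {ι : Type*} [Fintype ι] (M : Matrix ι ι ℂ) (x y : ι → ℂ) : ℂ :=
  ∑ a, ∑ b, conj (x a) * M a b * y b

theorem inner_toEuclideanCLM {ι : Type*} [Fintype ι] [DecidableEq ι] (M : Matrix ι ι ℂ)
    (x y : EuclideanSpace ℂ ι) :
    inner ℂ x (Matrix.toEuclideanCLM (𝕜 := ℂ) M y) = sesq M x.ofLp y.ofLp := by
  simp only [PiLp.inner_apply, RCLike.inner_apply, Matrix.ofLp_toEuclideanCLM, Matrix.mulVec,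
    dotProduct, sesq, Finset.sum_mul]
  refine Finset.sum_congr rfl fun i _ => Finset.sum_congr rfl fun j _ => ?_
  ring

/-- Complete positivity of a block positive map from `S₁` to scalar matrices, in coordinates. -/
theorem sum_sesq_nonneg {ι : Type*} [Fintype ι] {R : S1 →ₗ[ℂ] Matrix ι ι ℂ}
    (hR : ∀ x y, 0 ≤ sesq (R S1.unit) x x + sesq (R genU) x y +
      (sesq (R genUStar) y x + sesq (R S1.unit) y y)) {k : ℕ} {P : Matrix (Fin k) (Fin k) S1}
    (hP : P ∈ S1.cone k) (v : Fin k → ι → ℂ) : 0 ≤ ∑ p, ∑ q, sesq (R (P p q)) (v p) (v q) := by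
  classical
  let φ : S1 →ₗ[ℂ] (EuclideanSpace ℂ ι →L[ℂ] EuclideanSpace ℂ ι) :=
    (Matrix.toEuclideanCLM (n := ι) (𝕜 := ℂ)).toAlgEquiv.toLinearMap ∘ₗ R
  have hφ : ∀ s x y, inner ℂ x (φ s y) = sesq (R s) x.ofLp y.ofLp := fun s x y =>
    inner_toEuclideanCLM (R s) x y
  have hb : IsBlockPositive φ := by
    rw [IsBlockPositive, isPosMatrix_two]
    intro x y
    simp only [hφ]
    exact hR _ _
  have := isPosMatrix_map hb (mem_cone_iff.1 hP) fun p => WithLp.toLp 2 (v p)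
  simpa only [Matrix.map_apply, hφ] using this

/-- The functional `f ⊗ g` on `S₁ ⊗ S₁`. -/
def tensorFun (f g : S1 →ₗ[ℂ] ℂ) : S1 ⊗[ℂ] S1 →ₗ[ℂ] ℂ :=
  TensorProduct.lift ((LinearMap.mul ℂ ℂ).compl₁₂ f g)

@[simp] theorem tensorFun_tmul (f g : S1 →ₗ[ℂ] ℂ) (s t : S1) :
    tensorFun f g (s ⊗ₜ t) = f s * g t := rfl

/-- The dual witness `Θ : S₁ ⊗ S₁ → M₂`, with `Θ(1 ⊗ 1) = 1`, `Θ(u ⊗ u) = Θ(u* ⊗ u*) = diag(-1, 1)`,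
`Θ(u ⊗ u*) = Θ(u* ⊗ u) = [0, -1; -1, 0]` and all other values on the basis zero. -/
def witness : Matrix (Fin 2) (Fin 2) (S1 ⊗[ℂ] S1 →ₗ[ℂ] ℂ) :=
  !![tensorFun coeffUnit coeffUnit - (tensorFun coeffU coeffU + tensorFun coeffUStar coeffUStar),
      - (tensorFun coeffU coeffUStar + tensorFun coeffUStar coeffU);
     - (tensorFun coeffU coeffUStar + tensorFun coeffUStar coeffU),
      tensorFun coeffUnit coeffUnit + (tensorFun coeffU coeffU + tensorFun coeffUStar coeffUStar)]

/-- The generic positive Toeplitz matrix `[1, u; u*, 1]`. -/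
def toeplitzGen : Matrix (Fin 2) (Fin 2) S1 := !![S1.unit, genU; genUStar, S1.unit]

/-- The map `s ↦ [Θ(s ⊗ 1), Θ(s ⊗ u); Θ(s ⊗ u*), Θ(s ⊗ 1)]` into `M₂(M₂)`. -/
def witnessLeft : S1 →ₗ[ℂ] Matrix (Fin 2 × Fin 2) (Fin 2 × Fin 2) ℂ where
  toFun s := Matrix.of fun a b => witness a.2 b.2 (s ⊗ₜ toeplitzGen a.1 b.1)
  map_add' s t := by ext a b; simp [TensorProduct.add_tmul]
  map_smul' c s := by ext a b; simp [← TensorProduct.smul_tmul']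

/-- The map `t ↦ Θ(P ⊗ t)` into `M_k(M₂)`, for a matrix `P` over `S₁`. -/
def witnessRight {k : ℕ} (P : Matrix (Fin k) (Fin k) S1) :
    S1 →ₗ[ℂ] Matrix (Fin k × Fin 2) (Fin k × Fin 2) ℂ where
  toFun t := Matrix.of fun a b => witness a.2 b.2 (P a.1 b.1 ⊗ₜ t)
  map_add' s t := by ext a b; simp [TensorProduct.tmul_add]
  map_smul' c s := by ext a b; simp

/-- The map `witnessLeft` sends `1` to `1` and `u` to a signed permutation matrix, a unitary. -/
theorem sum_witnessLeft_nonneg {k : ℕ} {P : Matrix (Fin k) (Fin k) S1} (hP : P ∈ S1.cone k)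
    (v : Fin k → Fin 2 × Fin 2 → ℂ) :
    0 ≤ ∑ p, ∑ q, sesq (witnessLeft (P p q)) (v p) (v q) := by
  refine sum_sesq_nonneg (fun x y => ?_) hP v
  have h : ∀ q : ℂ, 0 ≤ conj q * q := fun q => by rw [Complex.conj_mul']; positivity
  -- the form is `∑ ‖x_b ± y_σ(b)‖²` for the signed permutation that represents `u`
  have key := add_nonneg (add_nonneg (h (x (0, 0) - y (1, 0))) (h (x (0, 1) + y (1, 1))))
    (add_nonneg (h (x (1, 0) - y (0, 1))) (h (x (1, 1) - y (0, 0))))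
  refine key.trans_eq ?_
  simp [sesq, witnessLeft, witness, toeplitzGen, Fintype.sum_prod_type, Fin.sum_univ_two]
  ring

/-- For positive `P` the block positivity of `witnessRight P` is the positivity of `witnessLeft` at
`P`. -/
theorem sum_witnessRight_nonneg {k m : ℕ} {P : Matrix (Fin k) (Fin k) S1} (hP : P ∈ S1.cone k)
    {Q : Matrix (Fin m) (Fin m) S1} (hQ : Q ∈ S1.cone m) (v : Fin m → Fin k × Fin 2 → ℂ) :
    0 ≤ ∑ p, ∑ q, sesq (witnessRight P (Q p q)) (v p) (v q) := by
  refine sum_sesq_nonneg (fun x y => ?_) hQ v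
  refine (sum_witnessLeft_nonneg hP fun p a =>
    if a.1 = 0 then x (p, a.2) else y (p, a.2)).trans_eq ?_
  simp only [sesq, witnessLeft, witnessRight, toeplitzGen, Fintype.sum_prod_type, Fin.sum_univ_two]
  simp [Finset.sum_add_distrib]
  ring

/-- The functional on `M₂(S₁ ⊗ S₁)` given by the pairing with `Θ`. -/
def witnessFun (X : Matrix (Fin 2) (Fin 2) (S1 ⊗[ℂ] S1)) : ℂ := ∑ i, ∑ j, witness i j (X i j)

theorem witnessFun_nonneg {X : Matrix (Fin 2) (Fin 2) (S1 ⊗[ℂ] S1)}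
    (hX : X ∈ preMaxCone S1 S1 2) : 0 ≤ witnessFun X := by
  obtain ⟨k, m, A, P, hP, Q, hQ, rfl⟩ := hX
  refine (sum_witnessRight_nonneg hP hQ fun p a => A (a.1, p) a.2).trans_eq ?_
  simp only [witnessFun, compress, Matrix.of_apply, map_sum, map_smul, sesq, witnessRight,
    LinearMap.coe_mk, AddHom.coe_mk, Fintype.sum_prod_type, smul_eq_mul]
  -- the two sums differ only in the order of summation
  let e : Fin m × Fin m × Fin k × Fin 2 × Fin k × Fin 2 ≃
      Fin 2 × Fin 2 × Fin k × Fin m × Fin k × Fin m :=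
    { toFun := fun (p, q, a, i, b, j) => (i, j, a, p, b, q)
      invFun := fun (i, j, a, p, b, q) => (p, q, a, i, b, j)
      left_inv := fun _ => rfl
      right_inv := fun _ => rfl }
  have h := e.sum_comp fun x : Fin 2 × Fin 2 × Fin k × Fin m × Fin k × Fin m =>
    conj (A (x.2.2.1, x.2.2.2.1) x.1) * A (x.2.2.2.2.1, x.2.2.2.2.2) x.2.1 *
      witness x.1 x.2.1 (P x.2.2.1 x.2.2.2.2.1 ⊗ₜ Q x.2.2.2.1 x.2.2.2.2.2)
  simp only [Fintype.sum_prod_type] at h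
  rw [← h]
  simp only [e, Equiv.coe_fn_mk, mul_right_comm]

theorem witnessFun_hMat (ε : ℂ) : witnessFun (ε • matrixUnit S1 S1 2 + hMat) = 2 * ε - 2 := by
  simp [witnessFun, witness, hMat, matrixUnit, Fin.sum_univ_two]
  ring

theorem hMat_notMem_maxCone : hMat ∉ maxCone S1 S1 2 := by
  intro h
  have h1 := witnessFun_nonneg (h (1 / 2) (by norm_num))
  rw [witnessFun_hMat] at h1
  have := (Complex.nonneg_iff.1 h1).1
  norm_num at this

end

/-! ### The identification with `C(𝕋)` and strict positivity of `h` -/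

noncomputable section

theorem univRep_mem_unitary {G : Type*} [Group G] (g : G) :
    univRep g ∈ unitary (UnivSpace G →L[ℂ] UnivSpace G) := by
  rw [Unitary.mem_iff]
  exact ⟨star_univRep_mul_self g, by rw [star_univRep, univRep_mul_inv]⟩

/-- Every point of the circle is an eigenvalue of `u`. -/
theorem spectrum_univRep :
    spectrum ℂ (univRep (FreeGroup.of 0 : F1)) = Metric.sphere 0 1 := by
  refine Set.Subset.antisymm (spectrum.subset_circle_of_unitary (univRep_mem_unitary _)) ?_
  intro z hz hu
  let w : Circle := ⟨z, hz⟩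
  have h0 : (algebraMap ℂ (UnivSpace F1 →L[ℂ] UnivSpace F1) z - univRep (FreeGroup.of 0) :
      UnivSpace F1 →L[ℂ] UnivSpace F1) (eigVec w) = 0 := by
    rw [_root_.sub_apply, univRep_eigVec, Algebra.algebraMap_eq_smul_one, _root_.smul_apply,
      one_apply_eq_self, sub_self]
  obtain ⟨V, hV⟩ := hu
  have h1 : (V⁻¹ : (UnivSpace F1 →L[ℂ] UnivSpace F1)ˣ).val (V.val (eigVec w)) = eigVec w := by
    rw [← mul_apply_eq_comp, Units.inv_mul, one_apply_eq_self]
  rw [hV, h0, map_zero] at h1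
  have := norm_eigVec w
  rw [← h1, norm_zero] at this
  exact zero_ne_one this

/-- The group `𝔽₁` is cyclic, so that `C*(𝔽₁)` is the C*-algebra generated by `u`. -/
theorem groupCStar_eq_elemental :
    groupCStar F1 = StarAlgebra.elemental ℂ (univRep (FreeGroup.of 0 : F1)) := by
  rw [groupCStar, StarAlgebra.elemental]
  congr 1
  refine le_antisymm (StarAlgebra.adjoin_le ?_) (StarAlgebra.adjoin_mono ?_)
  · rintro _ ⟨g, rfl⟩
    induction g using FreeGroup.induction_on with
    | C1 => rw [univRep_one]; exact one_mem _
    | of i =>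
      rw [Subsingleton.elim i 0]
      exact StarAlgebra.subset_adjoin ℂ _ rfl
    | inv_of i ih => rw [← star_univRep]; exact star_mem ih
    | mul x y hx hy => rw [univRep_mul]; exact mul_mem hx hy
  · rintro _ rfl
    exact ⟨_, rfl⟩

/-- The circle is the spectrum of `u`. -/
def circleHomeoSpectrum : Circle ≃ₜ spectrum ℂ (univRep (FreeGroup.of 0 : F1)) where
  toFun z := ⟨z, by rw [spectrum_univRep]; exact z.2⟩
  invFun z := ⟨z, spectrum_univRep.subset z.2⟩
  left_inv _ := rfl
  right_inv _ := rfl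
  continuous_toFun := by fun_prop
  continuous_invFun := by fun_prop

theorem exists_starAlgEquiv :
    ∃ Φ : groupCStar F1 ≃⋆ₐ[ℂ] C(Circle, ℂ), ∀ z : Circle, Φ (inclS1 genU) z = z := by
  set U := univRep (FreeGroup.of 0 : F1) with hU
  have hn : IsStarNormal U := ⟨by
    have h := Unitary.mem_iff.1 (univRep_mem_unitary (FreeGroup.of 0 : F1))
    rw [Commute, SemiconjBy, h.1, h.2]⟩
  have key : ∀ S : StarSubalgebra ℂ (UnivSpace F1 →L[ℂ] UnivSpace F1),
      S = StarAlgebra.elemental ℂ U → ∀ h : U ∈ S,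
      ∃ Φ : S ≃⋆ₐ[ℂ] C(Circle, ℂ), ∀ z : Circle, Φ ⟨U, h⟩ z = z := by
    rintro _ rfl h
    refine ⟨(continuousFunctionalCalculus U).symm.trans
      (circleHomeoSpectrum.compStarAlgEquiv' ℂ ℂ), fun z => ?_⟩
    have h1 : (continuousFunctionalCalculus U).symm ⟨U, h⟩ =
        (ContinuousMap.id ℂ).restrict (spectrum ℂ U) := by
      rw [StarAlgEquiv.symm_apply_eq]
      exact (continuousFunctionalCalculus_map_id U).symm
    rw [StarAlgEquiv.trans_apply, h1]
    rfl
  exact key _ groupCStar_eq_elemental _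

theorem evalS1_eq_ev {Φ : groupCStar F1 ≃⋆ₐ[ℂ] C(Circle, ℂ)}
    (hΦ : ∀ z : Circle, Φ (inclS1 genU) z = z) (z : Circle) : evalS1 Φ z = ev z := by
  refine linearMap_ext ?_ ?_ ?_
  · rw [ev_unit]
    change Φ 1 z = 1
    rw [map_one]; rfl
  · rw [ev_genU]; exact hΦ z
  · rw [ev_genUStar, ← hΦ z]
    change Φ (star (inclS1 genU)) z = _
    rw [map_star]; rfl

theorem evalTorus_eq_ev₂ {Φ : groupCStar F1 ≃⋆ₐ[ℂ] C(Circle, ℂ)}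
    (hΦ : ∀ z : Circle, Φ (inclS1 genU) z = z) (z w : Circle) : evalTorus Φ z w = ev₂ z w := by
  rw [evalTorus, evalS1_eq_ev hΦ, evalS1_eq_ev hΦ, ev₂]

theorem hMat_map_ev₂ (z w : Circle) : hMat.map (ev₂ z w) = hTorus z w := by
  have h : (z : ℂ) * w + conj (z : ℂ) * conj (w : ℂ) = 2 * (((z * w : ℂ).re : ℝ) : ℂ) := by
    rw [← map_mul, Complex.add_conj]; push_cast; rfl
  rw [hMat, hTorus, map_two, ← h]
  simp [mul_assoc]

theorem hTorus_sub_posSemidef (z w : Circle) :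
    (hTorus z w - ((1 / 10 : ℝ) : ℂ) • (1 : Matrix (Fin 2) (Fin 2) ℂ)).PosSemidef := by
  refine posSemidef_of_forall_nonneg fun v => ?_
  set r : ℝ := ((z : ℂ) * w).re with hr
  have hr1 : |r| ≤ 1 := by
    refine (Complex.abs_re_le_norm _).trans ?_
    rw [norm_mul, Circle.norm_coe, Circle.norm_coe, one_mul]
  set q : ℂ := conj (v 0) * conj (z : ℂ) * w * v 1 with hq
  have hqn : -(‖v 0‖ * ‖v 1‖) ≤ q.re := by
    have h1 := neg_le_of_abs_le (Complex.abs_re_le_norm q)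
    have h2 : ‖q‖ = ‖v 0‖ * ‖v 1‖ := by simp [hq, Circle.norm_coe]
    rwa [h2] at h1
  have h0 : conj (v 0) * v 0 = ((‖v 0‖ ^ 2 : ℝ) : ℂ) := by rw [Complex.conj_mul']; push_cast; rfl
  have h1 : conj (v 1) * v 1 = ((‖v 1‖ ^ 2 : ℝ) : ℂ) := by rw [Complex.conj_mul']; push_cast; rfl
  have hqq : q + conj q = ((2 * q.re : ℝ) : ℂ) := Complex.add_conj q
  have hsum : ∑ i, ∑ j, conj (v i) *
      (hTorus z w - ((1 / 10 : ℝ) : ℂ) • (1 : Matrix (Fin 2) (Fin 2) ℂ)) i j * v j =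
      (((29 / 10 + 2 * r) * ‖v 0‖ ^ 2 + (29 / 10 - 2 * r) * ‖v 1‖ ^ 2 + 4 * q.re : ℝ) : ℂ) := by
    have hconj : conj q = v 0 * z * conj (w : ℂ) * conj (v 1) := by simp [hq]
    rw [hconj, hq] at hqq
    simp only [hTorus, Fin.sum_univ_two, Matrix.sub_apply, Matrix.smul_apply, Matrix.of_apply,
      Matrix.cons_val', Matrix.cons_val_zero, Matrix.cons_val_one, Matrix.cons_val_fin_one,
      Matrix.one_apply_eq, Matrix.one_apply_ne, ne_eq, zero_ne_one, one_ne_zero, not_false_eq_true,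
      smul_eq_mul, mul_one, mul_zero, sub_zero, ← hr]
    push_cast at h0 h1 hqq ⊢
    linear_combination (29 / 10 + 2 * (r : ℂ)) * h0 + (29 / 10 - 2 * (r : ℂ)) * h1 + 2 * hqq
  rw [hsum, Complex.zero_le_real]
  obtain ⟨h2, h3⟩ := abs_le.1 hr1
  have hd : 0 < 29 / 10 + 2 * r := by linarith
  -- completing the square; the discriminant is `(29/10)² - 4r² - 4 > 0`
  have h4 : 0 ≤ (29 / 10 + 2 * r) * ((29 / 10 + 2 * r) * ‖v 0‖ ^ 2 +
      (29 / 10 - 2 * r) * ‖v 1‖ ^ 2 - 4 * (‖v 0‖ * ‖v 1‖)) := by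
    nlinarith [sq_nonneg ((29 / 10 + 2 * r) * ‖v 0‖ - 2 * ‖v 1‖),
      mul_nonneg (show 0 ≤ (29 / 10) ^ 2 - 4 * r ^ 2 - 4 by nlinarith) (sq_nonneg ‖v 1‖)]
  have h5 := nonneg_of_mul_nonneg_right h4 hd
  linarith

theorem isStrictlyPos_hMat : IsStrictlyPos (minCone S1 S1) hMat := by
  refine ⟨1 / 10, by norm_num, ?_⟩
  rw [minCone_eq_torusCone]
  intro z w
  have : (hMat - ((1 / 10 : ℝ) : ℂ) • matrixUnit S1 S1 2).map (ev₂ z w) =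
      hTorus z w - ((1 / 10 : ℝ) : ℂ) • 1 := by
    rw [← map_matrixUnit z w, ← hMat_map_ev₂]
    ext i j; simp
  rw [this]
  exact hTorus_sub_posSemidef z w

theorem hMat_mem_torusCone : hMat ∈ torusCone 2 := fun z w => by
  rw [hMat_map_ev₂]
  have := (hTorus_sub_posSemidef z w).add
    (Matrix.PosSemidef.one.smul (show (0 : ℂ) ≤ ((1 / 10 : ℝ) : ℂ) by
      exact_mod_cast (by norm_num : (0 : ℝ) ≤ 1 / 10)))
  rwa [sub_add_cancel] at this

end

end OpSysTensor

theorem mainTheorem1 :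
    -- the identity map from min to max is positive, but not 2-positive
    IsNPositive 1 (minCone S1 S1) (maxCone S1 S1)
      (TensorProduct.map (LinearMap.id : S1 →ₗ[ℂ] S1) (LinearMap.id : S1 →ₗ[ℂ] S1)) ∧
    ¬ IsNPositive 2 (minCone S1 S1) (maxCone S1 S1)
      (TensorProduct.map (LinearMap.id : S1 →ₗ[ℂ] S1) (LinearMap.id : S1 →ₗ[ℂ] S1)) ∧
    -- under the identification of the C*-algebra of the free group with the continuous functions
    -- on the circle, the witness is the matrix function h(z, w)
    (∃ Φ : groupCStar F1 ≃⋆ₐ[ℂ] C(Circle, ℂ),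
      (∀ z : Circle, Φ (inclS1 genU) z = z) ∧
      ∀ z w : Circle, hMat.map (evalTorus Φ z w) = hTorus z w) ∧
    -- the matrix function is uniformly strictly positive on the torus, the witness is strictly
    -- positive for min, and it does not lie in the max cone
    (∃ δ : ℝ, 0 < δ ∧ ∀ z w : Circle,
      (hTorus z w - (δ : ℂ) • (1 : Matrix (Fin 2) (Fin 2) ℂ)).PosSemidef) ∧
    IsStrictlyPos (minCone S1 S1) hMat ∧
    hMat ∉ maxCone S1 S1 2 ∧
    -- min equals c, and therefore c differs from max
    (∀ n : ℕ, minCone S1 S1 n = commCone.{0, 0, w} S1 S1 n) ∧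
    ¬ (∀ n : ℕ, commCone.{0, 0, w} S1 S1 n = maxCone S1 S1 n) := by
  have hid (n : ℕ) (X : Matrix (Fin n) (Fin n) (S1 ⊗[ℂ] S1)) :
      X.map (TensorProduct.map (LinearMap.id : S1 →ₗ[ℂ] S1) (LinearMap.id : S1 →ₗ[ℂ] S1)) = X := by
    rw [TensorProduct.map_id]
    rfl
  refine ⟨fun X hX => ?_, fun h => ?_, ?_, ⟨1 / 10, by norm_num, hTorus_sub_posSemidef⟩,
    isStrictlyPos_hMat, hMat_notMem_maxCone, fun n => ?_, fun h => ?_⟩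
  · rw [hid]
    exact torusCone_one_subset_maxCone (minCone_eq_torusCone 1 ▸ hX)
  · have := h hMat ((minCone_eq_torusCone 2).symm ▸ hMat_mem_torusCone)
    rw [hid] at this
    exact hMat_notMem_maxCone this
  · obtain ⟨Φ, hΦ⟩ := exists_starAlgEquiv
    exact ⟨Φ, hΦ, fun z w => by rw [evalTorus_eq_ev₂ hΦ, hMat_map_ev₂]⟩
  · rw [minCone_eq_torusCone, commCone_eq_torusCone]
  · refine hMat_notMem_maxCone ?_
    rw [← h 2, commCone_eq_torusCone]
    exact hMat_mem_torusCone
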